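/- Let $\ell,T,\delta_1>0$ and let $\varpi\subset\mathbb R^2$ be a bounded simply connected domain with $C^\infty$ boundary that contains the origin; $|\varpi|$ is its area and $d\sigma$ is arc length on $\partial\varpi$. Let $v_1=v_1(s,x_1,t)$ be a real function on $\mathbb R\times[0,\ell]\times[0,T]$ and $\varphi=\varphi(s,x_1,\xi,t)$ a real function on $\mathbb R\times[0,\ell]\times\overline\varpi\times[0,T]$ such that the following holds (conditions on $x_1$ or $t$ in an interval being understood for those $x_1\in[0,\ell]$, $t\in[0,T]$). (A2) $v_1\in C^\infty(\mathbb R\times[0,\ell]\times[0,T])$; $v_1$ does not depend on $x_1$ for $x_1\in[0,\delta_1]$, $t\in[0,\delta_1]$; for $(x_1,t)\in[\ell-\delta_1,\ell]\times[0,T]$ one has $v_1(s,x_1,t)=\mathrm v_1(t)\ge\varsigma_0$ with a constant $\varsigma_0>0$ and a function $\mathrm v_1$ of $t$ only; and there are constants $C_0,C_1$ with $0\le v_1\le C_0$ and $|s\,\partial_sv_1|+|s\,\partial^2_{ss}v_1|\le C_1$ everywhere. (A3) $\varphi\in C^\infty(\mathbb R\times[0,\ell]\times\overline\varpi\times[0,T])$;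 $\varphi=0$ for $x_1\in[0,\delta_1]$; $\varphi$ does not depend on $s$ for $x_1\in[\ell-\delta_1,\ell]$; and there are constants $C_2,C_3,C_4$ with $|\varphi|+|\partial_t\varphi|\le C_2|s|+C_3$ and $|\partial_s\varphi|\le C_4$ everywhere. (A5) $\varphi|_{t=0}=0$. Put $\widehat\varphi(s,x_1,t):=\frac1{|\varpi|}\int_{\partial\varpi}\varphi(s,x_1,\xi,t)\,d\sigma_\xi$. Assume moreover that $$v_1(s,0,t)+s\,\partial_sv_1(s,0,t)>0\quad\text{for all }(s,t)\in\mathbb R\times[0,T],$$ $$\widehat\varphi(s,x_1,t)\le0\quad\text{and}\quad\partial_{x_1}v_1(s,x_1,t)\le0\quad\text{for all }(s,x_1,t)\in[0,\infty)\times[0,\ell]\times[0,T].$$ Then there is a number $T_1\in(0,T]$ such that the problem $$\partial_tw_0+\partial_{x_1}\bigl(v_1(w_0,x_1,t)\,w_0\bigr)=-\widehat\varphi(w_0,x_1,t)\ \text{ in }(0,\ell)\times(0,T_1),$$ $$w_0(0,t)=0\ \ (t\in[0,T_1]),\qquad w_0(x_1,0)=0\ \ (x_1\in[0,\ell])$$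 has a unique classical solution $w_0\in C^1([0,\ell]\times[0,T_1])$. Moreover, $w_0\ge0$ on $[0,\ell]\times[0,T_1]$, and $\partial_tw_0(x_1,0)=0$ and $\partial_{x_1}w_0(x_1,0)=0$ for all $x_1\in[0,\ell]$. -/

import Mathlib

open Set MeasureTheory
open scoped ContDiff

noncomputable section

/-- The Euclidean plane that contains the cross-section of the tube. -/
abbrev Plane : Type := EuclideanSpace ℝ (Fin 2)

/-- A bounded simply connected plane domain with `C^∞` boundary that contains the origin.
Smoothness of the boundary: near each boundary point the domain is, after a rigid motion `e`
of the plane, the strict epigraph of a smooth function of one variable. -/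
structure IsCrossSection (ϖ : Set Plane) : Prop where
  isOpen : IsOpen ϖ
  isBounded : Bornology.IsBounded ϖ
  isSimplyConnected : IsSimplyConnected ϖ
  zero_mem : (0 : Plane) ∈ ϖ
  smooth_boundary : ∀ p ∈ frontier ϖ, ∃ r > 0, ∃ e : Plane ≃ᵃⁱ[ℝ] Plane, ∃ g : ℝ → ℝ,
    ContDiff ℝ ∞ g ∧ ∀ x ∈ Metric.ball p r, (x ∈ ϖ ↔ g (e x 0) < e x 1)

/-- Standing assumptions on the longitudinal velocity `v₁ = v s x t`
(`s` the concentration, `x ∈ [0, ℓ]`, `t ∈ [0, T]`). -/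
structure VelocityAssumption (ℓ T δ₁ : ℝ) (v : ℝ → ℝ → ℝ → ℝ) : Prop where
  smooth : ContDiffOn ℝ ∞ (fun p : ℝ × ℝ × ℝ => v p.1 p.2.1 p.2.2)
    (univ ×ˢ Icc 0 ℓ ×ˢ Icc 0 T)
  indep_left : ∀ s, ∀ x ∈ Icc 0 ℓ ∩ Icc 0 δ₁, ∀ y ∈ Icc 0 ℓ ∩ Icc 0 δ₁,
    ∀ t ∈ Icc 0 T ∩ Icc 0 δ₁, v s x t = v s y t
  right_end : ∃ vbar : ℝ → ℝ, ∃ ς₀ > 0,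
    ∀ s, ∀ x ∈ Icc 0 ℓ ∩ Icc (ℓ - δ₁) ℓ, ∀ t ∈ Icc 0 T, v s x t = vbar t ∧ ς₀ ≤ vbar t
  bound : ∃ C₀, ∀ s, ∀ x ∈ Icc 0 ℓ, ∀ t ∈ Icc 0 T, 0 ≤ v s x t ∧ v s x t ≤ C₀
  deriv_bound : ∃ C₁, ∀ s, ∀ x ∈ Icc 0 ℓ, ∀ t ∈ Icc 0 T,
    |s * deriv (fun r => v r x t) s| + |s * iteratedDeriv 2 (fun r => v r x t) s| ≤ C₁

/-- Standing assumptions on the interaction function `φ = φ s x ξ t`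
(`s` the concentration, `x ∈ [0, ℓ]`, `ξ` in the closed cross-section, `t ∈ [0, T]`). -/
structure InteractionAssumption (ℓ T δ₁ : ℝ) (ϖ : Set Plane) (φ : ℝ → ℝ → Plane → ℝ → ℝ) : Prop where
  smooth : ContDiffOn ℝ ∞ (fun p : ℝ × ℝ × Plane × ℝ => φ p.1 p.2.1 p.2.2.1 p.2.2.2)
    (univ ×ˢ Icc 0 ℓ ×ˢ closure ϖ ×ˢ Icc 0 T)
  vanish_left : ∀ s, ∀ x ∈ Icc 0 ℓ ∩ Icc 0 δ₁, ∀ ξ ∈ closure ϖ, ∀ t ∈ Icc 0 T, φ s x ξ t = 0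
  indep_right : ∀ s s', ∀ x ∈ Icc 0 ℓ ∩ Icc (ℓ - δ₁) ℓ, ∀ ξ ∈ closure ϖ, ∀ t ∈ Icc 0 T,
    φ s x ξ t = φ s' x ξ t
  growth : ∃ C₂ C₃, ∀ s, ∀ x ∈ Icc 0 ℓ, ∀ ξ ∈ closure ϖ, ∀ t ∈ Icc 0 T,
    |φ s x ξ t| + |derivWithin (fun τ => φ s x ξ τ) (Icc 0 T) t| ≤ C₂ * |s| + C₃
  deriv_bound : ∃ C₄, ∀ s, ∀ x ∈ Icc 0 ℓ, ∀ ξ ∈ closure ϖ, ∀ t ∈ Icc 0 T,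
    |deriv (fun r => φ r x ξ t) s| ≤ C₄

/-- The homogenized interaction: the integral of `φ` over the boundary curve of `ϖ` with respect
to arc length (one-dimensional Hausdorff measure), divided by the area of `ϖ`. -/
def phiHat (ϖ : Set Plane) (φ : ℝ → ℝ → Plane → ℝ → ℝ) (s x t : ℝ) : ℝ :=
  (1 / volume.real ϖ) * ∫ ξ in frontier ϖ, φ s x ξ t ∂(Measure.hausdorffMeasure 1)

/-- `w` is a classical (`C¹` up to the boundary) solution on `[0, ℓ] × [0, T₁]` of
`∂_t w + ∂_x (v₁(w, x, t) w) = - φ̂(w, x, t)` with `w(0, t) = 0` and `w(x, 0) = 0`. -/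
structure IsClassicalSolution (ℓ T₁ : ℝ) (ϖ : Set Plane) (v : ℝ → ℝ → ℝ → ℝ)
    (φ : ℝ → ℝ → Plane → ℝ → ℝ) (w : ℝ → ℝ → ℝ) : Prop where
  contDiffOn : ContDiffOn ℝ 1 (fun p : ℝ × ℝ => w p.1 p.2) (Icc 0 ℓ ×ˢ Icc 0 T₁)
  equation : ∀ x ∈ Ioo 0 ℓ, ∀ t ∈ Ioo 0 T₁,
    deriv (fun τ => w x τ) t + deriv (fun y => v (w y t) y t * w y t) x
      = - phiHat ϖ φ (w x t) x t
  boundary : ∀ t ∈ Icc 0 T₁, w 0 t = 0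
  initial : ∀ x ∈ Icc 0 ℓ, w x 0 = 0

end

/-!
The equation `∂_t w + ∂_x (v w) = - φ̂` is, in nonconservative form,
`∂_t w + a(w, x, t) ∂_x w = g(w, x, t)` with the characteristic speed `a = v + s ∂_s v`
(`charSpeed`) and the source `g = - φ̂ - s ∂_x v` (`charSource`), both smooth up to the boundary of
`ℝ × [0, ℓ] × [0, T]`. For `φ̂` this is differentiation under the integral sign, the boundary curve
of the cross-section being compact and of finite length.

Existence is the method of characteristics for the Cauchy problem on the whole `x`-line. The
coefficients are continued to `x ∉ [0, ℓ]` by their tangents and frozen for times outside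
`[0, min T δ₁]` (`extendCoef`); they become a planar field `F = (a, g)` that is `C¹` in the state
with locally Lipschitz derivative. The flow `z(y, t) = (X, U)` of `F` started at `(y, 0)` is `C¹` in
`(y, t)` on a two-sided time interval (`IsC11Field.exists_flow`): the `y`-derivative is the solution
of the first variation equation, which depends continuously on `y` because `F'` is Lipschitz. While
`∂_y X > 0`, the map `(y, t) ↦ (X, t)` has a `C¹` inverse, and `w = U ∘ inverse` is the solution
(`IsC11Field.exists_quasilinear_solution`). Near `x = 0` and for `t ≤ δ₁` the source vanishes, as
`φ = 0` and `v` does not depend on `x` there; so characteristics that reach `x = 0` within a short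
time carry the value `0`, which is the boundary condition.

Uniqueness and nonnegativity follow from a maximum principle for the transport inequality
`∂_t z + b ∂_x z ≤ K z` where `z > 0` (`nonpos_of_transport_inequality`), with data on `t = 0` and
`x = 0` only: at `x = ℓ` the speed `b` is nonnegative, so a positive maximum of `e^{-(K+1)t} z` is
impossible there too. It is applied to the difference of two solutions and to `- w`, with
`g(0, x, t) = - φ̂(0, x, t) ≥ 0`. The equation extends by continuity to the closed rectangle; at
`t = 0` it gives `∂_t w = g(0, x, 0) = 0`.
-/

/-! ### Short-time estimates and the first variation of a `C^{1,1}` field -/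

/-- The solution provided by the Picard-Lindelöf theorem stays in the ball in which the vector
field is controlled. -/
theorem IsPicardLindelof.exists_hasDerivWithinAt_mem_closedBall {E : Type*} [NormedAddCommGroup E]
    [NormedSpace ℝ E] [CompleteSpace E] {f : ℝ → E → E} {tmin tmax : ℝ} {t₀ : Icc tmin tmax}
    {x₀ x : E} {a r L K : NNReal} (hf : IsPicardLindelof f t₀ x₀ a r L K)
    (hx : x ∈ Metric.closedBall x₀ r) :
    ∃ α : ℝ → E, α t₀ = x ∧
      (∀ t ∈ Icc tmin tmax, HasDerivWithinAt α (f t (α t)) (Icc tmin tmax) t) ∧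
      ∀ t, α t ∈ Metric.closedBall x₀ a := by
  obtain ⟨α, hα⟩ := ODE.FunSpace.exists_isFixedPt_next hf hx
  refine ⟨α.compProj, by rw [ODE.FunSpace.compProj_val, ← hα, ODE.FunSpace.next_apply₀],
    fun t ht => ?_, fun t => α.compProj_mem_closedBall hf.mul_max_le⟩
  apply ODE.hasDerivWithinAt_picard_Icc t₀.2 hf.continuousOn_uncurry
    α.continuous_compProj.continuousOn
    (fun _ _ => α.compProj_mem_closedBall hf.mul_max_le) x ht |>.congr_of_mem _ ht
  intro t' ht'
  nth_rw 1 [← hα]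
  rw [ODE.FunSpace.compProj_of_mem ht', ODE.FunSpace.next_apply]

/-- A two-sided Grönwall-type estimate on a short time interval. -/
theorem norm_le_two_mul_of_norm_deriv_le {E : Type*} [NormedAddCommGroup E] [NormedSpace ℝ E]
    {D D' : ℝ → E} {ε K c : ℝ} (hε : 0 < ε) (hK : 0 ≤ K) (hKε : K * ε ≤ 1 / 2)
    (hD : ∀ t ∈ Icc (-ε) ε, HasDerivWithinAt D (D' t) (Icc (-ε) ε) t)
    (hb : ∀ t ∈ Icc (-ε) ε, ‖D' t‖ ≤ K * ‖D t‖ + c) :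
    ∀ t ∈ Icc (-ε) ε, ‖D t‖ ≤ 2 * (‖D 0‖ + ε * c) := by
  have h0 : (0 : ℝ) ∈ Icc (-ε) ε := ⟨by linarith, hε.le⟩
  have hcont : ContinuousOn (fun t => ‖D t‖) (Icc (-ε) ε) :=
    ContinuousOn.norm fun t ht => (hD t ht).continuousWithinAt
  obtain ⟨m, hm, hmax⟩ := isCompact_Icc.exists_isMaxOn ⟨0, h0⟩ hcont
  have hmax' : ∀ t ∈ Icc (-ε) ε, ‖D t‖ ≤ ‖D m‖ := fun t ht => hmax ht
  have hmv := (convex_Icc (-ε) ε).norm_image_sub_le_of_norm_hasDerivWithin_le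
    (C := K * ‖D m‖ + c) hD
    (fun t ht => (hb t ht).trans (by gcongr; exact hmax' t ht)) h0 hm
  have hnn : 0 ≤ K * ‖D m‖ + c :=
    (norm_nonneg _).trans (hb m hm)
  have hmabs : ‖m - 0‖ ≤ ε := by
    rw [sub_zero, Real.norm_eq_abs, abs_le]; exact hm
  have h1 : ‖D m‖ ≤ ‖D 0‖ + (K * ‖D m‖ + c) * ε := by
    have := norm_sub_norm_le (D m) (D 0)
    have := mul_le_mul_of_nonneg_left hmabs hnn
    linarith
  have h2 : K * ε * ‖D m‖ ≤ 1 / 2 * ‖D m‖ := by gcongr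
  intro t ht
  have := hmax' t ht
  nlinarith

/-- A time-dependent vector field on a set `B` that is bounded, continuous, and differentiable in
space with bounded and Lipschitz continuous derivative; `M` bounds all the constants. -/
structure IsC11Field {E : Type*} [NormedAddCommGroup E] [NormedSpace ℝ E]
    (F : ℝ → E → E) (F' : ℝ → E → E →L[ℝ] E) (B : Set E) (M : ℝ) : Prop where
  continuous : Continuous (Function.uncurry F)
  continuous_deriv : ∀ z, Continuous (fun t => F' t z)
  hasFDerivAt : ∀ t, ∀ z ∈ B, HasFDerivAt (F t) (F' t z) z
  norm_le : ∀ t, ∀ z ∈ B, ‖F t z‖ ≤ M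
  norm_deriv_le : ∀ t, ∀ z ∈ B, ‖F' t z‖ ≤ M
  lipschitz_deriv : ∀ t, ∀ z ∈ B, ∀ z' ∈ B, ‖F' t z - F' t z'‖ ≤ M * ‖z - z'‖

namespace IsC11Field

variable {E : Type*} [NormedAddCommGroup E] [NormedSpace ℝ E]
  {F : ℝ → E → E} {F' : ℝ → E → E →L[ℝ] E} {B : Set E} {M : ℝ}

/-- The vector field of the first variation: the equation `z' = F t z` together with its
linearization `j' = F' t z j` along the solution. -/
def variation (F : ℝ → E → E) (F' : ℝ → E → E →L[ℝ] E) (t : ℝ) (p : E × E) : E × E :=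
  (F t p.1, F' t p.1 p.2)

theorem norm_sub_le (h : IsC11Field F F' B M) (hB : Convex ℝ B) (t : ℝ) {z z' : E}
    (hz : z ∈ B) (hz' : z' ∈ B) : ‖F t z - F t z'‖ ≤ M * ‖z - z'‖ :=
  hB.norm_image_sub_le_of_norm_hasFDerivWithin_le
    (fun x hx => (h.hasFDerivAt t x hx).hasFDerivWithinAt) (fun x hx => h.norm_deriv_le t x hx)
    hz' hz

theorem norm_sub_sub_le (h : IsC11Field F F' B M) (hB : Convex ℝ B) (hM : 0 ≤ M) (t : ℝ)
    {z z' : E} (hz : z ∈ B) (hz' : z' ∈ B) :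
    ‖F t z' - F t z - F' t z (z' - z)‖ ≤ M * ‖z' - z‖ ^ 2 := by
  have hseg : segment ℝ z z' ⊆ B := hB.segment_subset hz hz'
  have := (convex_segment z z').norm_image_sub_le_of_norm_hasFDerivWithin_le'
    (f := F t) (f' := F' t) (φ := F' t z) (C := M * ‖z' - z‖)
    (fun x hx => (h.hasFDerivAt t x (hseg hx)).hasFDerivWithinAt)
    (fun x hx => (h.lipschitz_deriv t x (hseg hx) z hz).trans
      (by gcongr; exact norm_sub_le_of_mem_segment hx))
    (left_mem_segment ℝ z z') (right_mem_segment ℝ z z')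
  calc _ ≤ _ := this
    _ = _ := by ring

theorem norm_variation_le (h : IsC11Field F F' B M) (hM : 0 ≤ M) (t : ℝ) {p : E × E}
    (hp : p ∈ B ×ˢ Metric.closedBall (0 : E) 2) : ‖variation F F' t p‖ ≤ 2 * M := by
  have h2 : ‖p.2‖ ≤ 2 := by simpa using hp.2
  refine max_le ((h.norm_le t _ hp.1).trans (by linarith)) ?_
  calc ‖F' t p.1 p.2‖ ≤ ‖F' t p.1‖ * ‖p.2‖ := ContinuousLinearMap.le_opNorm _ _
    _ ≤ M * 2 := by gcongr; exact h.norm_deriv_le t _ hp.1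
    _ = 2 * M := by ring

theorem norm_variation_sub_le (h : IsC11Field F F' B M) (hB : Convex ℝ B) (hM : 0 ≤ M) (t : ℝ)
    {p q : E × E} (hp : p ∈ B ×ˢ Metric.closedBall (0 : E) 2)
    (hq : q ∈ B ×ˢ Metric.closedBall (0 : E) 2) :
    ‖variation F F' t p - variation F F' t q‖ ≤ 3 * M * ‖p - q‖ := by
  have h2 : ‖p.2‖ ≤ 2 := by simpa using hp.2
  have hl : ‖p.1 - q.1‖ ≤ ‖p - q‖ := norm_fst_le (p - q)
  have hr : ‖p.2 - q.2‖ ≤ ‖p - q‖ := norm_snd_le (p - q)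
  have h0 := norm_nonneg (p - q)
  refine max_le ((h.norm_sub_le hB t hp.1 hq.1).trans ?_) ?_
  · nlinarith [mul_le_mul_of_nonneg_left hl hM]
  · change ‖F' t p.1 p.2 - F' t q.1 q.2‖ ≤ _
    have e : F' t p.1 p.2 - F' t q.1 q.2
        = (F' t p.1 - F' t q.1) p.2 + F' t q.1 (p.2 - q.2) := by
      simp [map_sub]
    rw [e]
    calc _ ≤ ‖(F' t p.1 - F' t q.1) p.2‖ + ‖F' t q.1 (p.2 - q.2)‖ := norm_add_le _ _
      _ ≤ ‖F' t p.1 - F' t q.1‖ * ‖p.2‖ + ‖F' t q.1‖ * ‖p.2 - q.2‖ :=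
        add_le_add (ContinuousLinearMap.le_opNorm _ _) (ContinuousLinearMap.le_opNorm _ _)
      _ ≤ (M * ‖p - q‖) * 2 + M * ‖p - q‖ := by
        gcongr
        · exact (h.lipschitz_deriv t _ hp.1 _ hq.1).trans (by gcongr)
        · exact h.norm_deriv_le t _ hq.1
      _ = _ := by ring

/-- Picard-Lindelöf for the first variation, on a time interval that does not depend on the
initial value. -/
theorem exists_variation_solution [CompleteSpace E] (h : IsC11Field F F' B M) (hB : Convex ℝ B)
    {ρ ε : ℝ} (hρ : 0 < ρ) (hρ1 : ρ ≤ 1) (hε : 0 < ε) (hM : 0 ≤ M) (hMε : 2 * M * ε ≤ ρ)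
    {z₀ j₀ : E} (hz₀ : Metric.closedBall z₀ ρ ⊆ B) (hj₀ : ‖j₀‖ ≤ 1) :
    ∃ Z : ℝ → E × E, Z 0 = (z₀, j₀) ∧
      (∀ t ∈ Icc (-ε) ε, HasDerivWithinAt Z (variation F F' t (Z t)) (Icc (-ε) ε) t) ∧
      ∀ t, (Z t).1 ∈ Metric.closedBall z₀ ρ ∧ (Z t).2 ∈ Metric.closedBall j₀ ρ := by
  have hsub : Metric.closedBall (z₀, j₀) ρ ⊆ B ×ˢ Metric.closedBall (0 : E) 2 := by
    rw [← closedBall_prod_same]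
    refine prod_mono hz₀ (Metric.closedBall_subset_closedBall' ?_)
    rw [dist_zero_right]; linarith
  have h0 : (0 : ℝ) ∈ Icc (-ε) ε := ⟨by linarith, hε.le⟩
  have hPL : IsPicardLindelof (variation F F') (tmin := -ε) (tmax := ε)
      ⟨0, h0⟩ (z₀, j₀) ⟨ρ, hρ.le⟩ 0 ⟨2 * M, by positivity⟩
      ⟨3 * M, by positivity⟩ := by
    refine ⟨fun t _ => LipschitzOnWith.of_dist_le_mul fun p hp q hq => ?_, fun p _ => ?_,
      fun t _ p hp => h.norm_variation_le hM t (hsub hp), ?_⟩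
    · rw [dist_eq_norm, dist_eq_norm]
      exact h.norm_variation_sub_le hB hM t (hsub hp) (hsub hq)
    · refine Continuous.continuousOn ?_
      exact (h.continuous.comp (by fun_prop : Continuous fun t : ℝ => (t, p.1))).prodMk
        ((h.continuous_deriv p.1).clm_apply continuous_const)
    · simp only [sub_zero, zero_sub, neg_neg, max_self, NNReal.coe_zero]
      exact hMε
  have hx : (z₀, j₀) ∈ Metric.closedBall (z₀, j₀) ((0 : NNReal) : ℝ) := by simp
  obtain ⟨Z, hZ0, hZ, hmem⟩ := hPL.exists_hasDerivWithinAt_mem_closedBall hx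
  refine ⟨Z, hZ0, hZ, fun t => ?_⟩
  have := hmem t
  rw [← closedBall_prod_same] at this
  exact this

end IsC11Field

/-! ### Smooth dependence of the flow on the initial value -/

/-- A two-parameter family with continuous partial derivatives on an open rectangle is strictly
differentiable there and `C^1`. -/
theorem hasStrictFDerivAt_of_partial_deriv {E : Type*} [NormedAddCommGroup E]
    [NormedSpace ℝ E] {z a b : ℝ → ℝ → E} {U : Set (ℝ × ℝ)}
    (hU : IsOpen U)
    (h1 : ∀ p ∈ U, HasDerivAt (fun y => z y p.2) (a p.1 p.2) p.1)
    (h2 : ∀ p ∈ U, HasDerivAt (fun t => z p.1 t) (b p.1 p.2) p.2)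
    (ha : ContinuousOn (fun p : ℝ × ℝ => a p.1 p.2) U)
    (hb : ContinuousOn (fun p : ℝ × ℝ => b p.1 p.2) U) {p : ℝ × ℝ} (hp : p ∈ U) :
    HasStrictFDerivAt (fun p : ℝ × ℝ => z p.1 p.2)
      ((ContinuousLinearMap.toSpanSingleton ℝ (a p.1 p.2)).coprod
        (ContinuousLinearMap.toSpanSingleton ℝ (b p.1 p.2))) p := by
  have hc : Continuous fun x : E => ContinuousLinearMap.toSpanSingleton ℝ x :=
    (ContinuousLinearMap.toSpanSingletonCLE (𝕜 := ℝ) (E := E)).continuous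
  exact hasStrictFDerivAt_uncurry_coprod (𝕜 := ℝ) (f := z)
    (f₁ := fun y t => ContinuousLinearMap.toSpanSingleton ℝ (a y t))
    (f₂ := fun y t => ContinuousLinearMap.toSpanSingleton ℝ (b y t))
    (Filter.mem_of_superset (hU.mem_nhds hp) fun q hq => (h1 q hq).hasFDerivAt)
    (Filter.mem_of_superset (hU.mem_nhds hp) fun q hq => (h2 q hq).hasFDerivAt)
    (hc.continuousAt.comp (ha.continuousAt (hU.mem_nhds hp)))
    (hc.continuousAt.comp (hb.continuousAt (hU.mem_nhds hp)))

theorem contDiffOn_one_of_partial_deriv {E : Type*} [NormedAddCommGroup E]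
    [NormedSpace ℝ E] {z a b : ℝ → ℝ → E} {U : Set (ℝ × ℝ)}
    (hU : IsOpen U)
    (h1 : ∀ p ∈ U, HasDerivAt (fun y => z y p.2) (a p.1 p.2) p.1)
    (h2 : ∀ p ∈ U, HasDerivAt (fun t => z p.1 t) (b p.1 p.2) p.2)
    (ha : ContinuousOn (fun p : ℝ × ℝ => a p.1 p.2) U)
    (hb : ContinuousOn (fun p : ℝ × ℝ => b p.1 p.2) U) :
    ContDiffOn ℝ 1 (fun p : ℝ × ℝ => z p.1 p.2) U := by
  have hc : Continuous fun x : E => ContinuousLinearMap.toSpanSingleton ℝ x :=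
    (ContinuousLinearMap.toSpanSingletonCLE (𝕜 := ℝ) (E := E)).continuous
  have := (contDiffOn_succ_iff_hasFDerivWithinAt_of_uniqueDiffOn (𝕜 := ℝ) (n := 0)
    (f := fun p : ℝ × ℝ => z p.1 p.2) hU.uniqueDiffOn).2
    ⟨by simp, _, contDiffOn_zero.2 ?_, fun p hp =>
      (hasStrictFDerivAt_of_partial_deriv hU h1 h2 ha hb hp).hasFDerivAt.hasFDerivWithinAt⟩
  · simpa using this
  · refine (((hc.comp_continuousOn ha).clm_comp (continuousOn_const (c :=
      ContinuousLinearMap.fst ℝ ℝ ℝ))).add ((hc.comp_continuousOn hb).clm_comp (continuousOn_const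
      (c := ContinuousLinearMap.snd ℝ ℝ ℝ)))).congr fun p _ => ?_
    ext <;> simp

namespace IsC11Field

variable {E : Type*} [NormedAddCommGroup E] [NormedSpace ℝ E]
  {F : ℝ → E → E} {F' : ℝ → E → E →L[ℝ] E} {B : Set E} {M : ℝ}

/-- The flow of a `C^{1,1}` field, started on the line `y ↦ c + y • j₀`, is continuously
differentiable in time and in the parameter `y`; the derivative `j` in the parameter solves the
first variation equation. -/
theorem exists_flow [CompleteSpace E] (h : IsC11Field F F' B M) (hB : Convex ℝ B)
    {ρ ε : ℝ} (hρ : 0 < ρ) (hρ1 : ρ ≤ 1) (hε : 0 < ε) (hM : 0 ≤ M) (hMε : 2 * M * ε ≤ ρ)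
    (hMε' : 3 * M * ε ≤ 1 / 2) {c j₀ : E} (hj₀ : ‖j₀‖ ≤ 1) {I : Set ℝ} (hI : IsOpen I)
    (hIB : ∀ y ∈ I, Metric.closedBall (c + y • j₀) ρ ⊆ B) :
    ∃ z j : ℝ → ℝ → E,
      (∀ y ∈ I, z y 0 = c + y • j₀) ∧
      (∀ y ∈ I, ∀ t, z y t ∈ Metric.closedBall (c + y • j₀) ρ ∧ j y t ∈ Metric.closedBall j₀ ρ) ∧
      (∀ y ∈ I, ∀ t ∈ Ioo (-ε) ε, HasDerivAt (z y) (F t (z y t)) t) ∧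
      (∀ y ∈ I, ∀ t ∈ Ioo (-ε) ε, HasDerivAt (fun y => z y t) (j y t) y) ∧
      ContinuousOn (fun p : ℝ × ℝ => z p.1 p.2) (I ×ˢ Ioo (-ε) ε) ∧
      ContinuousOn (fun p : ℝ × ℝ => j p.1 p.2) (I ×ˢ Ioo (-ε) ε) := by
  choose! Z hZ0 hZ hZmem using fun y (hy : y ∈ I) =>
    h.exists_variation_solution hB hρ hρ1 hε hM hMε (hIB y hy) hj₀
  have hZB : ∀ y ∈ I, ∀ t, Z y t ∈ B ×ˢ Metric.closedBall (0 : E) 2 := fun y hy t =>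
    ⟨hIB y hy (hZmem y hy t).1, Metric.closedBall_subset_closedBall'
      (by rw [dist_zero_right]; linarith) (hZmem y hy t).2⟩
  -- the solutions of the first variation depend Lipschitz continuously on `y` and `t`
  have hlip : ∀ y ∈ I, ∀ y' ∈ I, ∀ t ∈ Icc (-ε) ε, ‖Z y' t - Z y t‖ ≤ 2 * |y' - y| := by
    intro y hy y' hy' t ht
    have := norm_le_two_mul_of_norm_deriv_le (D := fun t => Z y' t - Z y t) (c := 0) hε
      (by positivity : 0 ≤ 3 * M) hMε' (fun t ht => (hZ y' hy' t ht).sub (hZ y hy t ht))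
      (fun t _ => by
        rw [add_zero]; exact h.norm_variation_sub_le hB hM t (hZB y' hy' t) (hZB y hy t)) t ht
    refine this.trans ?_
    rw [hZ0 y hy, hZ0 y' hy']
    have e : ((c + y' • j₀, j₀) : E × E) - (c + y • j₀, j₀) = ((y' - y) • j₀, 0) := by
      simp [sub_smul]
    rw [e, mul_zero, add_zero]
    have : ‖(((y' - y) • j₀, 0) : E × E)‖ ≤ |y' - y| := by
      rw [Prod.norm_def, norm_zero, max_eq_left (norm_nonneg _), norm_smul, Real.norm_eq_abs]
      exact mul_le_of_le_one_right (abs_nonneg _) hj₀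
    linarith
  have hlip_t : ∀ y ∈ I, ∀ t ∈ Icc (-ε) ε, ∀ t' ∈ Icc (-ε) ε,
      ‖Z y t' - Z y t‖ ≤ 2 * M * |t' - t| := fun y hy t ht t' ht' =>
    (convex_Icc (-ε) ε).norm_image_sub_le_of_norm_hasDerivWithin_le (hZ y hy)
      (fun t _ => h.norm_variation_le hM t (hZB y hy t)) ht ht'
  have hcont : ContinuousOn (fun p : ℝ × ℝ => Z p.1 p.2) (I ×ˢ Ioo (-ε) ε) := by
    have hL : LipschitzOnWith (Real.toNNReal (2 + 2 * M)) (fun p : ℝ × ℝ => Z p.1 p.2)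
        (I ×ˢ Ioo (-ε) ε) := by
      refine LipschitzOnWith.of_dist_le_mul fun p hp q hq => ?_
      rw [dist_eq_norm, dist_eq_norm, Real.coe_toNNReal _ (by positivity)]
      have h1 : |p.1 - q.1| ≤ ‖p - q‖ := norm_fst_le (p - q)
      have h2 : |p.2 - q.2| ≤ ‖p - q‖ := norm_snd_le (p - q)
      calc ‖Z p.1 p.2 - Z q.1 q.2‖
          = ‖(Z p.1 p.2 - Z q.1 p.2) + (Z q.1 p.2 - Z q.1 q.2)‖ := by congr 1; abel
        _ ≤ ‖Z p.1 p.2 - Z q.1 p.2‖ + ‖Z q.1 p.2 - Z q.1 q.2‖ := norm_add_le _ _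
        _ ≤ 2 * |p.1 - q.1| + 2 * M * |p.2 - q.2| := add_le_add
            (hlip _ hq.1 _ hp.1 _ (Ioo_subset_Icc_self hp.2))
            (hlip_t _ hq.1 _ (Ioo_subset_Icc_self hq.2) _ (Ioo_subset_Icc_self hp.2))
        _ ≤ 2 * ‖p - q‖ + 2 * M * ‖p - q‖ := by gcongr
        _ = _ := by ring
    exact hL.continuousOn
  refine ⟨fun y t => (Z y t).1, fun y t => (Z y t).2, fun y hy => by simp [hZ0 y hy],
    fun y hy t => hZmem y hy t, fun y hy t ht => ?_, fun y hy t ht => ?_,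
    hcont.fst, hcont.snd⟩
  · simpa [variation] using ((hZ y hy t (Ioo_subset_Icc_self ht)).hasDerivAt
      (Icc_mem_nhds ht.1 ht.2)).hasFDerivAt.fst.hasDerivAt
  -- the remainder of the first order expansion in `y` solves the linearized equation up to a
  -- quadratic error
  have hquad : ∀ y' ∈ I, ‖(Z y' t).1 - (Z y t).1 - (y' - y) • (Z y t).2‖
      ≤ (2 * ε * (4 * M)) * ‖y' - y‖ ^ 2 := by
    intro y' hy'
    have hfst : ∀ y ∈ I, ∀ t ∈ Icc (-ε) ε,
        HasDerivWithinAt (fun t => (Z y t).1) (F t (Z y t).1) (Icc (-ε) ε) t := fun y hy t ht =>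
      by simpa [variation] using (hZ y hy t ht).hasFDerivWithinAt.fst.hasDerivWithinAt
    have hsnd : ∀ t ∈ Icc (-ε) ε, HasDerivWithinAt (fun t => (Z y t).2)
        (F' t (Z y t).1 (Z y t).2) (Icc (-ε) ε) t := fun t ht =>
      by simpa [variation] using (hZ y hy t ht).hasFDerivWithinAt.snd.hasDerivWithinAt
    have := norm_le_two_mul_of_norm_deriv_le (K := M) (c := 4 * M * |y' - y| ^ 2)
      (D := fun t => (Z y' t).1 - (Z y t).1 - (y' - y) • (Z y t).2) hε hM (by nlinarith)
      (fun t ht => ((hfst y' hy' t ht).sub (hfst y hy t ht)).sub ((hsnd t ht).const_smul (y' - y)))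
      (fun t ht => ?_) t (Ioo_subset_Icc_self ht)
    · refine this.trans (le_of_eq ?_)
      simp only [hZ0 y hy, hZ0 y' hy', Real.norm_eq_abs]
      rw [show c + y' • j₀ - (c + y • j₀) - (y' - y) • j₀ = 0 by rw [sub_smul]; abel, norm_zero]
      ring
    · have e : F t (Z y' t).1 - F t (Z y t).1 - (y' - y) • F' t (Z y t).1 (Z y t).2
          = F' t (Z y t).1 ((Z y' t).1 - (Z y t).1 - (y' - y) • (Z y t).2)
            + (F t (Z y' t).1 - F t (Z y t).1 - F' t (Z y t).1 ((Z y' t).1 - (Z y t).1)) := by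
        simp only [map_sub, map_smul]; abel
      rw [e]
      refine (norm_add_le _ _).trans (add_le_add ?_ ?_)
      · exact (ContinuousLinearMap.le_opNorm _ _).trans
          (by gcongr; exact h.norm_deriv_le t _ (hZB y hy t).1)
      · refine (h.norm_sub_sub_le hB hM t (hZB y hy t).1 (hZB y' hy' t).1).trans ?_
        have h1 : ‖(Z y' t).1 - (Z y t).1‖ ≤ 2 * |y' - y| :=
          (norm_fst_le (Z y' t - Z y t)).trans (hlip y hy y' hy' t ht)
        calc M * ‖(Z y' t).1 - (Z y t).1‖ ^ 2 ≤ M * (2 * |y' - y|) ^ 2 := by gcongr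
          _ = _ := by ring
  rw [hasDerivAt_iff_isLittleO]
  refine (Asymptotics.IsBigO.of_bound (2 * ε * (4 * M)) ?_).trans_isLittleO
    (Asymptotics.isLittleO_pow_sub_sub y one_lt_two)
  filter_upwards [hI.mem_nhds hy] with y' hy'
  rw [norm_pow, norm_norm]
  exact hquad y' hy'

end IsC11Field

/-! ### The method of characteristics -/

/-- The invertible linear map `(a, b) ↦ (p a + q b, b)` of the plane. -/
noncomputable def shearEquiv (p q : ℝ) (hp : p ≠ 0) : (ℝ × ℝ) ≃L[ℝ] (ℝ × ℝ) :=
  ContinuousLinearEquiv.equivOfInverse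
    ((p • ContinuousLinearMap.fst ℝ ℝ ℝ + q • ContinuousLinearMap.snd ℝ ℝ ℝ).prod
      (ContinuousLinearMap.snd ℝ ℝ ℝ))
    ((p⁻¹ • (ContinuousLinearMap.fst ℝ ℝ ℝ - q • ContinuousLinearMap.snd ℝ ℝ ℝ)).prod
      (ContinuousLinearMap.snd ℝ ℝ ℝ))
    (fun x => by ext <;> simp [hp]) (fun x => by ext <;> simp [hp])

/-- Local solvability of `∂_t w + A(t, x, w) ∂_x w = G(t, x, w)`, `w(x, 0) = 0`, by the method of
characteristics, for the field `F = (A, G)`. The time interval is symmetric about `0`, so the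
solution is `C¹` in a full neighbourhood of `[0, ℓ] × {0}`. Since `G` vanishes for `x ≤ 2 ρ`, so
does `w` at `x = 0`. -/
theorem IsC11Field.exists_quasilinear_solution {F : ℝ → ℝ × ℝ → ℝ × ℝ}
    {F' : ℝ → ℝ × ℝ → ℝ × ℝ →L[ℝ] ℝ × ℝ} {M ℓ ρ ε : ℝ}
    (h : IsC11Field F F' (Icc (-2) (ℓ + 2) ×ˢ Icc (-1) 1) M) (hℓ : 0 < ℓ)
    (hρ : 0 < ρ) (hρ1 : ρ ≤ 1 / 2) (hε : 0 < ε) (hM : 0 ≤ M) (hMε : 2 * M * ε ≤ ρ)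
    (hMε' : 3 * M * ε ≤ 1 / 2)
    (hG : ∀ t, ∀ z : ℝ × ℝ, z.1 ≤ 2 * ρ → (F t z).2 = 0) :
    ∃ w : ℝ × ℝ → ℝ,
      (∀ x ∈ Icc 0 ℓ, ∀ t ∈ Ioo (-ε) ε, ContDiffAt ℝ 1 w (x, t)) ∧
      (∀ x ∈ Icc 0 ℓ, ∀ t ∈ Ioo (-ε) ε,
        fderiv ℝ w (x, t) ((F t (x, w (x, t))).1, 1) = (F t (x, w (x, t))).2) ∧
      (∀ x ∈ Icc 0 ℓ, w (x, 0) = 0) ∧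
      (∀ t ∈ Ioo (-ε) ε, w (0, t) = 0) := by
  have hball : ∀ y u : ℝ, ∀ p : ℝ × ℝ, p ∈ Metric.closedBall (y, u) ρ ↔
      |p.1 - y| ≤ ρ ∧ |p.2 - u| ≤ ρ := fun y u p => by
    rw [← closedBall_prod_same]; rfl
  have hline : ∀ y : ℝ, ((0, 0) : ℝ × ℝ) + y • (1, 0) = (y, 0) := fun y => by simp
  set I : Set ℝ := Ioo (-1) (ℓ + 1) with hIdef
  obtain ⟨z, j, hz0, hmem, hzt, hzy, hzc, hjc⟩ :=
    h.exists_flow ((convex_Icc _ _).prod (convex_Icc _ _)) hρ (by linarith) hε hM hMε hMε'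
      (c := (0, 0)) (j₀ := (1, 0)) (by simp [Prod.norm_def]) (I := I) isOpen_Ioo (by
        intro y hy p hp
        rw [hline, hball] at hp
        obtain ⟨h1, h2⟩ := abs_le.1 hp.1
        obtain ⟨h3, h4⟩ := abs_le.1 hp.2
        exact ⟨⟨by linarith [hy.1], by linarith [hy.2]⟩, ⟨by linarith, by linarith⟩⟩)
  simp only [hline] at hz0 hmem
  set D : Set (ℝ × ℝ) := I ×ˢ Ioo (-ε) ε with hDdef
  have hD : IsOpen D := isOpen_Ioo.prod isOpen_Ioo
  have hFc : ContinuousOn (fun p : ℝ × ℝ => F p.2 (z p.1 p.2)) D :=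
    h.continuous.comp_continuousOn (continuousOn_snd.prodMk hzc)
  have h1 : ∀ p ∈ D, HasDerivAt (fun y => z y p.2) (j p.1 p.2) p.1 := fun p hp =>
    hzy p.1 hp.1 p.2 hp.2
  have h2 : ∀ p ∈ D, HasDerivAt (fun t => z p.1 t) (F p.2 (z p.1 p.2)) p.2 := fun p hp =>
    hzt p.1 hp.1 p.2 hp.2
  have hzC : ∀ p ∈ D, ContDiffAt ℝ 1 (fun p : ℝ × ℝ => z p.1 p.2) p := fun p hp =>
    (contDiffOn_one_of_partial_deriv (b := fun y t => F t (z y t)) hD h1 h2 hjc hFc).contDiffAt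
      (hD.mem_nhds hp)
  have hzD : ∀ p ∈ D, HasFDerivAt (fun p : ℝ × ℝ => z p.1 p.2) _ p := fun p hp =>
    (hasStrictFDerivAt_of_partial_deriv (b := fun y t => F t (z y t)) hD h1 h2 hjc hFc
      hp).hasFDerivAt
  -- the projection of the characteristics to the `(x, t)` plane
  set Θ : ℝ × ℝ → ℝ × ℝ := fun p => ((z p.1 p.2).1, p.2) with hΘ
  have hΘC : ∀ p ∈ D, ContDiffAt ℝ 1 Θ p := fun p hp => (hzC p hp).fst.prodMk contDiffAt_snd
  have hjpos : ∀ p ∈ D, 0 < (j p.1 p.2).1 := fun p hp => by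
    have := ((hball _ _ _).1 (hmem p.1 hp.1 p.2).2).1
    linarith [(abs_le.1 this).1]
  have hΘD : ∀ p (hp : p ∈ D), HasFDerivAt Θ
      ((shearEquiv (j p.1 p.2).1 (F p.2 (z p.1 p.2)).1 (hjpos p hp).ne' :
        (ℝ × ℝ) ≃L[ℝ] (ℝ × ℝ)) : (ℝ × ℝ) →L[ℝ] (ℝ × ℝ)) p := fun p hp =>
    ((hzD p hp).fst.prodMk hasFDerivAt_snd).congr_fderiv (by ext <;> simp [shearEquiv])
  have hinj : InjOn Θ D := by
    rintro ⟨y, t⟩ hp ⟨y', t'⟩ hp' he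
    obtain ⟨he1, rfl⟩ : (z y t).1 = (z y' t').1 ∧ t = t' := by simpa [hΘ] using he
    have hd : ∀ y ∈ I, HasDerivAt (fun y => (z y t).1) (j y t).1 y := fun y hy => by
      simpa using (hzy y hy t hp.2).hasFDerivAt.fst.hasDerivAt
    have hmono : StrictMonoOn (fun y => (z y t).1) I := by
      refine strictMonoOn_of_deriv_pos (convex_Ioo _ _)
        (fun y hy => (hd y hy).continuousAt.continuousWithinAt) fun y hy => ?_
      rw [interior_Ioo] at hy
      rw [(hd y hy).deriv]
      exact hjpos (y, t) ⟨hy, hp.2⟩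
    exact Prod.ext (hmono.injOn hp.1 hp'.1 he1) rfl
  have hsurj : ∀ x ∈ Icc 0 ℓ, ∀ t ∈ Ioo (-ε) ε, ∃ y ∈ I, (z y t).1 = x := by
    intro x hx t ht
    have hsub : Icc (-3 / 4) (ℓ + 3 / 4) ⊆ I := fun y hy =>
      ⟨by linarith [hy.1], by linarith [hy.2]⟩
    have hc : ContinuousOn (fun y => (z y t).1) (Icc (-3 / 4) (ℓ + 3 / 4)) := fun y hy =>
      (hzy y (hsub hy) t ht).continuousAt.fst.continuousWithinAt
    have hl := ((hball _ _ _).1 (hmem (-3 / 4) (hsub ⟨le_rfl, by linarith⟩) t).1).1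
    have hr := ((hball _ _ _).1 (hmem (ℓ + 3 / 4) (hsub ⟨by linarith, le_rfl⟩) t).1).1
    obtain ⟨y, hy, hyx⟩ := intermediate_value_Icc (by linarith) hc
      (show x ∈ Icc _ _ from ⟨by linarith [(abs_le.1 hl).2, hx.1],
        by linarith [(abs_le.1 hr).1, hx.2]⟩)
    exact ⟨y, hsub hy, hyx⟩
  set g : ℝ × ℝ → ℝ × ℝ := Function.invFunOn Θ D with hg
  have hgΘ : ∀ p ∈ D, g (Θ p) = p := fun p hp => hinj.leftInvOn_invFunOn hp
  have hgC : ∀ p ∈ D, ContDiffAt ℝ 1 g (Θ p) := fun p hp => by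
    refine ((hΘC p hp).to_localInverse (hΘD p hp) one_ne_zero).congr_of_eventuallyEq ?_
    exact ((hΘC p hp).hasStrictFDerivAt' (hΘD p hp) one_ne_zero).localInverse_unique
      (Filter.mem_of_superset (hD.mem_nhds hp) hgΘ)
  set w : ℝ × ℝ → ℝ := fun q => (z (g q).1 (g q).2).2 with hw
  have hwΘ : ∀ p ∈ D, w (Θ p) = (z p.1 p.2).2 := fun p hp => by simp only [hw, hgΘ p hp]
  have hwC : ∀ p ∈ D, ContDiffAt ℝ 1 w (Θ p) := fun p hp => by
    have h3 : ContDiffAt ℝ 1 (fun p : ℝ × ℝ => z p.1 p.2) (g (Θ p)) := by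
      rw [hgΘ p hp]; exact hzC p hp
    exact (h3.comp (Θ p) (hgC p hp)).snd
  refine ⟨w, fun x hx t ht => ?_, fun x hx t ht => ?_, fun x hx => ?_, fun t ht => ?_⟩
  · obtain ⟨y, hy, rfl⟩ := hsurj x hx t ht
    exact hwC (y, t) ⟨hy, ht⟩
  · obtain ⟨y, hy, rfl⟩ := hsurj x hx t ht
    have hp : (y, t) ∈ D := ⟨hy, ht⟩
    -- differentiate `w ∘ Θ = z.2` along the characteristic through `(y, 0)`
    have hcomp : HasFDerivAt (w ∘ Θ) _ (y, t) :=
      (((hwC _ hp).differentiableAt one_ne_zero).hasFDerivAt).comp (y, t) (hΘD _ hp)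
    have hu : HasFDerivAt (w ∘ Θ) _ (y, t) :=
      (hzD _ hp).snd.congr_of_eventuallyEq (Filter.mem_of_superset (hD.mem_nhds hp) hwΘ)
    have he := congrArg (fun L : ℝ × ℝ →L[ℝ] ℝ => L (0, 1)) (hcomp.unique hu)
    have hwp := hwΘ _ hp
    simp only [hΘ] at hwp
    rw [hwp]
    simpa [shearEquiv, hΘ] using he
  · have h0 : (0 : ℝ) ∈ Ioo (-ε) ε := ⟨by linarith, hε⟩
    have hxI : x ∈ I := ⟨by linarith [hx.1], by linarith [hx.2]⟩
    have := hwΘ (x, 0) ⟨hxI, h0⟩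
    simpa [hΘ, hz0 x hxI] using this
  · obtain ⟨y, hy, hyx⟩ := hsurj 0 ⟨le_rfl, hℓ.le⟩ t ht
    have := hwΘ (y, t) ⟨hy, ht⟩
    simp only [hΘ, hyx] at this
    rw [this]
    -- the characteristic through `(0, t)` stays where the source vanishes
    have hclose : ∀ τ, |(z y τ).1 - y| ≤ ρ := fun τ => ((hball _ _ _).1 (hmem y hy τ).1).1
    have hyρ : y ≤ ρ := by
      have := abs_le.1 (hclose t)
      rw [hyx] at this
      linarith [this.1]
    have hd : ∀ τ ∈ Ioo (-ε) ε, HasDerivAt (fun τ => (z y τ).2) 0 τ := fun τ hτ => by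
      have h3 := (hzt y hy τ hτ).hasFDerivAt.snd.hasDerivAt
      have h4 : (F τ (z y τ)).2 = 0 := hG τ _ (by linarith [(abs_le.1 (hclose τ)).2])
      simpa [h4] using h3
    have h0 : (0 : ℝ) ∈ Ioo (-ε) ε := ⟨by linarith, hε⟩
    have hconst := isOpen_Ioo.is_const_of_deriv_eq_zero isPreconnected_Ioo
      (fun τ hτ => (hd τ hτ).differentiableAt.differentiableWithinAt)
      (fun τ hτ => (hd τ hτ).deriv) ht h0
    rw [hconst, hz0 y hy]

/-! ### Integrals depending on a parameter and the homogenized interaction -/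

section ParametricIntegral

variable {E X : Type} [NormedAddCommGroup E] [NormedAddCommGroup X] [MeasurableSpace X]
  [BorelSpace X] {μ : Measure X} {S : Set E} {K : Set X}

theorem ContinuousOn.integrableOn_section {G : Type} [NormedAddCommGroup G] {f : E → X → G}
    (hf : ContinuousOn (Function.uncurry f) (S ×ˢ K)) (hK : IsCompact K) (hμ : μ K ≠ ⊤) {q : E}
    (hq : q ∈ S) : IntegrableOn (f q) K μ := by
  have hc : ContinuousOn (f q) K :=
    hf.comp (by fun_prop : ContinuousOn (fun ξ => (q, ξ)) K) fun ξ hξ => ⟨hq, hξ⟩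
  obtain ⟨C, hC⟩ := hK.exists_bound_of_continuousOn hc
  have : IsFiniteMeasure (μ.restrict K) := ⟨by simpa using hμ.lt_top⟩
  exact Integrable.of_bound (hc.aestronglyMeasurable_of_isCompact hK hK.measurableSet) C
    ((ae_restrict_iff' hK.measurableSet).2 (.of_forall hC))

/-- An integral over a compact set of finite measure depends continuously on a parameter. -/
theorem continuousOn_setIntegral_of_isCompact {G : Type} [NormedAddCommGroup G] [NormedSpace ℝ G]
    {f : E → X → G} (hf : ContinuousOn (Function.uncurry f) (S ×ˢ K)) (hK : IsCompact K)
    (hμ : μ K ≠ ⊤) : ContinuousOn (fun q => ∫ ξ in K, f q ξ ∂μ) S := by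
  intro q hq
  rw [ContinuousWithinAt, Metric.tendsto_nhds]
  intro ε hε
  obtain ⟨v, hv, hvK⟩ := hK.mem_uniformity_of_prod hf hq
    (Metric.dist_mem_uniformity (show 0 < ε / (μ.real K + 1) by positivity))
  filter_upwards [hv, self_mem_nhdsWithin] with p hp hpS
  rw [dist_eq_norm, ← integral_sub (hf.integrableOn_section hK hμ hpS)
    (hf.integrableOn_section hK hμ hq)]
  refine (norm_setIntegral_le_of_norm_le_const (C := ε / (μ.real K + 1)) hμ.lt_top
    fun ξ hξ => ?_).trans_lt ?_
  · rw [← dist_eq_norm]; exact (hvK p hp ξ hξ).le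
  · rw [div_mul_eq_mul_div, div_lt_iff₀ (by positivity)]
    nlinarith

variable [NormedSpace ℝ E]

/-- Differentiation under the integral sign, within a convex set and over a compact set of finite
measure. -/
theorem hasFDerivWithinAt_setIntegral_of_isCompact {G : Type} [NormedAddCommGroup G]
    [NormedSpace ℝ G] [CompleteSpace G] {f : E → X → G} {f' : E → X → E →L[ℝ] G}
    (hS : Convex ℝ S) (hK : IsCompact K) (hμ : μ K ≠ ⊤)
    (hf : ContinuousOn (Function.uncurry f) (S ×ˢ K))
    (hf' : ContinuousOn (Function.uncurry f') (S ×ˢ K))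
    (hd : ∀ q ∈ S, ∀ ξ ∈ K, HasFDerivWithinAt (fun q => f q ξ) (f' q ξ) S q) {q : E}
    (hq : q ∈ S) :
    HasFDerivWithinAt (fun q => ∫ ξ in K, f q ξ ∂μ) (∫ ξ in K, f' q ξ ∂μ) S q := by
  rw [hasFDerivWithinAt_iff_isLittleO, Asymptotics.isLittleO_iff]
  intro ε hε
  obtain ⟨v, hv, hvK⟩ := hK.mem_uniformity_of_prod hf' hq
    (Metric.dist_mem_uniformity (show 0 < ε / (μ.real K + 1) by positivity))
  obtain ⟨r, hr, hrv⟩ := Metric.mem_nhdsWithin_iff.1 hv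
  filter_upwards [inter_mem_nhdsWithin S (Metric.ball_mem_nhds q hr)] with p hp
  have hint : IntegrableOn (fun ξ => f' q ξ (p - q)) K μ :=
    (hf'.integrableOn_section hK hμ hq).apply_continuousLinearMap _
  have hint' : IntegrableOn (fun ξ => f p ξ - f q ξ) K μ :=
    (hf.integrableOn_section hK hμ hp.1).sub (hf.integrableOn_section hK hμ hq)
  rw [ContinuousLinearMap.integral_apply (hf'.integrableOn_section hK hμ hq),
    ← integral_sub (hf.integrableOn_section hK hμ hp.1) (hf.integrableOn_section hK hμ hq),
    ← integral_sub hint' hint]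
  refine (norm_setIntegral_le_of_norm_le_const (C := ε / (μ.real K + 1) * ‖p - q‖) hμ.lt_top
    fun ξ hξ => ?_).trans ?_
  · refine ((convex_ball q r).inter hS).norm_image_sub_le_of_norm_hasFDerivWithin_le'
      (f := fun q => f q ξ) (f' := fun q => f' q ξ)
      (fun x hx => (hd x hx.2 ξ hξ).mono inter_subset_right) (fun x hx => ?_)
      ⟨Metric.mem_ball_self hr, hq⟩ ⟨hp.2, hp.1⟩
    rw [← dist_eq_norm]
    exact (hvK x (hrv hx) ξ hξ).le
  · have h1 : ε / (μ.real K + 1) * μ.real K ≤ ε := by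
      rw [div_mul_eq_mul_div, div_le_iff₀ (by positivity)]
      nlinarith
    calc _ = ε / (μ.real K + 1) * μ.real K * ‖p - q‖ := by ring
      _ ≤ _ := by gcongr

variable [NormedSpace ℝ X]

theorem contDiffOn_nat_setIntegral_of_isCompact (hS : Convex ℝ S) (hSu : UniqueDiffOn ℝ S)
    (hK : IsCompact K) (hμ : μ K ≠ ⊤) (n : ℕ) :
    ∀ {G : Type} [NormedAddCommGroup G] [NormedSpace ℝ G] [CompleteSpace G] {f : E → X → G},
      ContDiffOn ℝ n (Function.uncurry f) (S ×ˢ K) →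
      ContDiffOn ℝ n (fun q => ∫ ξ in K, f q ξ ∂μ) S := by
  induction n with
  | zero =>
    intro G _ _ _ f hf
    exact contDiffOn_zero.2 (continuousOn_setIntegral_of_isCompact hf.continuousOn hK hμ)
  | succ n ih =>
    intro G _ _ _ f hf
    have hf' : ContDiffOn ℝ n
        (Function.uncurry fun q ξ => fderivWithin ℝ (fun q => f q ξ) S q) (S ×ˢ K) := by
      intro p hp
      refine ContDiffWithinAt.fderivWithin (n := ((n + 1 : ℕ) : WithTop ℕ∞))
        (f := fun (p : E × X) (q : E) => f q p.2) (g := Prod.fst) ?_ contDiffWithinAt_fst hSu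
        (by simp) hp fun x hx => hx.1
      exact (hf (p.1, p.2) hp).comp (t := S ×ˢ K)
        (g := Function.uncurry f) (f := fun x : (E × X) × E => (x.2, x.1.2)) (p, p.1)
        (by fun_prop) fun x hx => ⟨hx.2, hx.1.2⟩
    have hd : ∀ q ∈ S, ∀ ξ ∈ K, HasFDerivWithinAt (fun q => f q ξ)
        (fderivWithin ℝ (fun q => f q ξ) S q) S q := fun q hq ξ hξ => by
      have h1 : ContDiffWithinAt ℝ (n + 1 : ℕ) (fun q => f q ξ) S q :=
        (hf (q, ξ) ⟨hq, hξ⟩).comp (t := S ×ˢ K) (g := Function.uncurry f)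
          (f := fun q => (q, ξ)) q (by fun_prop) fun x hx => ⟨hx, hξ⟩
      exact (h1.differentiableWithinAt (by simp)).hasFDerivWithinAt
    push_cast
    refine (contDiffOn_succ_iff_hasFDerivWithinAt_of_uniqueDiffOn hSu).2
      ⟨by simp, _, ih hf', fun q hq => hasFDerivWithinAt_setIntegral_of_isCompact hS hK hμ
        hf.continuousOn hf'.continuousOn hd hq⟩

/-- An integral over a compact set of finite measure depends smoothly on parameters in a convex
set with unique derivatives, as soon as the integrand is smooth up to the boundary. -/
theorem contDiffOn_infty_setIntegral_of_isCompact {G : Type} [NormedAddCommGroup G]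
    [NormedSpace ℝ G] [CompleteSpace G] {f : E → X → G} (hS : Convex ℝ S)
    (hSu : UniqueDiffOn ℝ S) (hK : IsCompact K) (hμ : μ K ≠ ⊤)
    (hf : ContDiffOn ℝ ∞ (Function.uncurry f) (S ×ˢ K)) :
    ContDiffOn ℝ ∞ (fun q => ∫ ξ in K, f q ξ ∂μ) S :=
  contDiffOn_infty.2 fun n => contDiffOn_nat_setIntegral_of_isCompact hS hSu hK hμ n
    (contDiffOn_infty.1 hf n)

end ParametricIntegral

theorem IsCrossSection.isCompact_frontier {ϖ : Set Plane} (h : IsCrossSection ϖ) :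
    IsCompact (frontier ϖ) :=
  Metric.isCompact_of_isClosed_isBounded isClosed_frontier
    (h.isBounded.closure.subset frontier_subset_closure)

/-- The boundary curve of a cross-section has finite length: locally it is a Lipschitz image of an
interval. -/
theorem IsCrossSection.hausdorffMeasure_frontier_ne_top {ϖ : Set Plane} (h : IsCrossSection ϖ) :
    (Measure.hausdorffMeasure 1 : Measure Plane) (frontier ϖ) ≠ ⊤ := by
  refine (h.isCompact_frontier.measure_lt_top_of_nhdsWithin fun p hp => ?_).ne
  obtain ⟨r, hr, e, g, hg, hgϖ⟩ := h.smooth_boundary p hp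
  refine ⟨frontier ϖ ∩ Metric.ball p r, inter_mem_nhdsWithin _ (Metric.ball_mem_nhds p hr), ?_⟩
  set γ : ℝ → Plane := fun u => !₂[u, g u] with hγ
  have hγC : ContDiff ℝ 1 γ := by
    rw [contDiff_euclidean]
    intro i
    fin_cases i
    · exact contDiff_id
    · exact hg.of_le (by simp)
  obtain ⟨C, hC⟩ := (hγC.contDiffOn (s := Icc (e p 0 - r) (e p 0 + r))).exists_lipschitzOnWith
    one_ne_zero (convex_Icc _ _) isCompact_Icc
  have hcoord : ∀ i, Continuous fun x => e x i := fun i =>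
    (EuclideanSpace.proj i : Plane →L[ℝ] ℝ).continuous.comp e.continuous
  have hsub : frontier ϖ ∩ Metric.ball p r ⊆ e.symm '' (γ '' Icc (e p 0 - r) (e p 0 + r)) := by
    rintro x ⟨hx, hxr⟩
    have hxϖ : x ∉ ϖ := by
      rw [h.isOpen.frontier_eq] at hx; exact hx.2
    have hle : e x 1 ≤ g (e x 0) := not_lt.1 fun hlt => hxϖ ((hgϖ x hxr).2 hlt)
    have heq : e x 1 = g (e x 0) := by
      refine hle.antisymm (not_lt.1 fun hlt => ?_)
      have hopen : IsOpen {y | e y 1 < g (e y 0)} :=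
        isOpen_lt (hcoord 1) (hg.continuous.comp (hcoord 0))
      obtain ⟨y, ⟨hy1, hy2⟩, hyϖ⟩ := mem_closure_iff.1 hx.1 _ (hopen.inter Metric.isOpen_ball)
        ⟨hlt, hxr⟩
      exact lt_asymm hy1 ((hgϖ y hy2).1 hyϖ)
    refine ⟨e x, ⟨e x 0, ?_, ?_⟩, e.symm_apply_apply x⟩
    · have h1 : ‖(e x - e p) 0‖ ≤ ‖e x - e p‖ := PiLp.norm_apply_le _ 0
      rw [← dist_eq_norm, e.dist_map] at h1
      have h2 : |e x 0 - e p 0| ≤ r := h1.trans (Metric.mem_ball.1 hxr).le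
      rw [abs_le] at h2
      exact ⟨by linarith [h2.1], by linarith [h2.2]⟩
    · ext i
      fin_cases i
      · rfl
      · exact heq.symm
  refine (measure_mono hsub).trans_lt ?_
  rw [e.symm.isometry.hausdorffMeasure_image (Or.inl zero_le_one)]
  refine (hC.hausdorffMeasure_image_le zero_le_one).trans_lt ?_
  rw [hausdorffMeasure_real, Real.volume_Icc]
  exact ENNReal.mul_lt_top (by simp) ENNReal.ofReal_lt_top

/-- The set `ℝ × [0, ℓ] × [0, T]` of the arguments `(s, x, t)` of the coefficients. -/
abbrev coefDomain (ℓ T : ℝ) : Set (ℝ × ℝ × ℝ) := univ ×ˢ Icc 0 ℓ ×ˢ Icc 0 T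

theorem convex_coefDomain (ℓ T : ℝ) : Convex ℝ (coefDomain ℓ T) :=
  convex_univ.prod ((convex_Icc _ _).prod (convex_Icc _ _))

theorem uniqueDiffOn_coefDomain {ℓ T : ℝ} (hℓ : 0 < ℓ) (hT : 0 < T) :
    UniqueDiffOn ℝ (coefDomain ℓ T) :=
  uniqueDiffOn_univ.prod ((uniqueDiffOn_Icc hℓ).prod (uniqueDiffOn_Icc hT))

/-- The homogenized interaction is smooth up to the boundary of the space-time rectangle. -/
theorem InteractionAssumption.contDiffOn_phiHat {ℓ T δ₁ : ℝ} (hℓ : 0 < ℓ) (hT : 0 < T)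
    {ϖ : Set Plane} (hϖ : IsCrossSection ϖ) {φ : ℝ → ℝ → Plane → ℝ → ℝ}
    (hφ : InteractionAssumption ℓ T δ₁ ϖ φ) :
    ContDiffOn ℝ ∞ (fun p : ℝ × ℝ × ℝ => phiHat ϖ φ p.1 p.2.1 p.2.2) (coefDomain ℓ T) := by
  refine contDiffOn_const.mul (contDiffOn_infty_setIntegral_of_isCompact
    (f := fun (p : ℝ × ℝ × ℝ) ξ => φ p.1 p.2.1 ξ p.2.2) (convex_coefDomain ℓ T)
    (uniqueDiffOn_coefDomain hℓ hT) hϖ.isCompact_frontier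
    hϖ.hausdorffMeasure_frontier_ne_top ?_)
  exact hφ.smooth.comp (f := fun p : (ℝ × ℝ × ℝ) × Plane => (p.1.1, p.1.2.1, p.2, p.1.2.2))
    (by fun_prop) fun p hp => ⟨mem_univ _, hp.1.2.1, frontier_subset_closure hp.2, hp.1.2.2⟩

/-! ### Extension of the coefficients -/

/-- The partial derivative in `s` of a function of `(s, x, t)` on `ℝ × [0, ℓ] × [0, T]`. -/
noncomputable def partialS (ℓ T : ℝ) (h : ℝ × ℝ × ℝ → ℝ) (p : ℝ × ℝ × ℝ) : ℝ :=
  fderivWithin ℝ h (coefDomain ℓ T) p (1, 0, 0)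

/-- The partial derivative in `x` of a function of `(s, x, t)` on `ℝ × [0, ℓ] × [0, T]`, one-sided
at `x = 0` and `x = ℓ`. -/
noncomputable def partialX (ℓ T : ℝ) (h : ℝ × ℝ × ℝ → ℝ) (p : ℝ × ℝ × ℝ) : ℝ :=
  fderivWithin ℝ h (coefDomain ℓ T) p (0, 1, 0)

section Coefficients

variable {ℓ T : ℝ} {h : ℝ × ℝ × ℝ → ℝ}

theorem contDiffOn_partialS (hℓ : 0 < ℓ) (hT : 0 < T) (hh : ContDiffOn ℝ ∞ h (coefDomain ℓ T)) :
    ContDiffOn ℝ ∞ (partialS ℓ T h) (coefDomain ℓ T) :=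
  (hh.fderivWithin (uniqueDiffOn_coefDomain hℓ hT) (by simp)).clm_apply contDiffOn_const

theorem contDiffOn_partialX (hℓ : 0 < ℓ) (hT : 0 < T) (hh : ContDiffOn ℝ ∞ h (coefDomain ℓ T)) :
    ContDiffOn ℝ ∞ (partialX ℓ T h) (coefDomain ℓ T) :=
  (hh.fderivWithin (uniqueDiffOn_coefDomain hℓ hT) (by simp)).clm_apply contDiffOn_const

theorem hasDerivAt_partialS (hh : ContDiffOn ℝ ∞ h (coefDomain ℓ T)) (s : ℝ) {x t : ℝ}
    (hx : x ∈ Icc 0 ℓ) (ht : t ∈ Icc 0 T) :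
    HasDerivAt (fun s => h (s, x, t)) (partialS ℓ T h (s, x, t)) s := by
  have h1 := ((hh (s, x, t) ⟨mem_univ _, hx, ht⟩).differentiableWithinAt (by simp)).hasFDerivWithinAt
  have h2 : HasDerivWithinAt (fun s : ℝ => (s, x, t)) (1, 0, 0) univ s :=
    (hasDerivWithinAt_id s univ).prodMk (hasDerivWithinAt_const s univ (x, t))
  exact hasDerivWithinAt_univ.1
    (h1.comp_hasDerivWithinAt s h2 (t := coefDomain ℓ T) fun s _ => ⟨mem_univ _, hx, ht⟩)

theorem hasDerivWithinAt_partialX (hh : ContDiffOn ℝ ∞ h (coefDomain ℓ T)) (s : ℝ) {x t : ℝ}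
    (hx : x ∈ Icc 0 ℓ) (ht : t ∈ Icc 0 T) :
    HasDerivWithinAt (fun x => h (s, x, t)) (partialX ℓ T h (s, x, t)) (Icc 0 ℓ) x := by
  have h1 := ((hh (s, x, t) ⟨mem_univ _, hx, ht⟩).differentiableWithinAt (by simp)).hasFDerivWithinAt
  have h2 : HasDerivWithinAt (fun x : ℝ => (s, x, t)) (0, 1, 0) (Icc 0 ℓ) x :=
    (hasDerivWithinAt_const x _ s).prodMk ((hasDerivWithinAt_id x _).prodMk
      (hasDerivWithinAt_const x _ t))
  exact h1.comp_hasDerivWithinAt x h2 (t := coefDomain ℓ T) fun x hx => ⟨mem_univ _, hx, ht⟩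

/-- A smooth coefficient is bounded and Lipschitz continuous for bounded `s`. -/
theorem exists_bound_lipschitz (hh : ContDiffOn ℝ ∞ h (coefDomain ℓ T)) (N : ℝ) :
    ∃ C, 0 ≤ C ∧ (∀ s ∈ Icc (-N) N, ∀ r ∈ Icc (0 : ℝ) ℓ ×ˢ Icc (0 : ℝ) T, |h (s, r)| ≤ C) ∧
      ∀ s ∈ Icc (-N) N, ∀ s' ∈ Icc (-N) N, ∀ r ∈ Icc (0 : ℝ) ℓ ×ˢ Icc (0 : ℝ) T,
        ∀ r' ∈ Icc (0 : ℝ) ℓ ×ˢ Icc (0 : ℝ) T,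
        |h (s, r) - h (s', r')| ≤ C * ‖(s, r) - (s', r')‖ := by
  have hK : IsCompact (Icc (-N) N ×ˢ Icc (0 : ℝ) ℓ ×ˢ Icc (0 : ℝ) T) :=
    isCompact_Icc.prod (isCompact_Icc.prod isCompact_Icc)
  have hsub := hh.mono (prod_mono_left (subset_univ (Icc (-N) N)))
  obtain ⟨C, hC⟩ := hK.exists_bound_of_continuousOn hsub.continuousOn
  obtain ⟨L, hL⟩ := hsub.exists_lipschitzOnWith (by simp)
    ((convex_Icc _ _).prod ((convex_Icc _ _).prod (convex_Icc _ _))) hK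
  refine ⟨max C L, le_max_of_le_right L.2, fun s hs r hr => (hC _ ⟨hs, hr⟩).trans (le_max_left _ _),
    fun s hs s' hs' r hr r' hr' => ?_⟩
  have := hL.dist_le_mul (s, r) ⟨hs, hr⟩ (s', r') ⟨hs', hr'⟩
  rw [dist_eq_norm, dist_eq_norm] at this
  exact this.trans (by gcongr; exact le_max_right _ _)

/-- The nearest point of `[0, a]`. -/
def clamp (a x : ℝ) : ℝ := max 0 (min a x)

theorem clamp_mem {a : ℝ} (ha : 0 ≤ a) (x : ℝ) : clamp a x ∈ Icc 0 a :=
  ⟨le_max_left _ _, max_le ha (min_le_left _ _)⟩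

theorem clamp_of_mem {a x : ℝ} (hx : x ∈ Icc 0 a) : clamp a x = x := by
  rw [clamp, min_eq_right hx.2, max_eq_right hx.1]

theorem clamp_of_nonpos {a x : ℝ} (ha : 0 ≤ a) (hx : x ≤ 0) : clamp a x = 0 := by
  rw [clamp, min_eq_right (hx.trans ha), max_eq_left hx]

theorem clamp_of_ge {a x : ℝ} (ha : 0 ≤ a) (hx : a ≤ x) : clamp a x = a := by
  rw [clamp, min_eq_left hx, max_eq_right ha]

theorem continuous_clamp (a : ℝ) : Continuous (clamp a) := by
  unfold clamp; fun_prop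

theorem abs_clamp_sub_le (a x y : ℝ) : |clamp a x - clamp a y| ≤ |x - y| := by
  rw [clamp, clamp, max_comm 0, max_comm 0]
  exact (abs_max_sub_max_le_abs _ _ _).trans (by simpa using abs_min_sub_min_le_max a x a y)

theorem abs_sub_clamp_le {a x c : ℝ} (ha : 0 ≤ a) (hc : 0 ≤ c) (hx : x ∈ Icc (-c) (a + c)) :
    |x - clamp a x| ≤ c := by
  rcases le_total x 0 with h0 | h0
  · rw [clamp_of_nonpos ha h0, abs_le]; constructor <;> linarith [hx.1]
  rcases le_total x a with h1 | h1
  · rw [clamp_of_mem ⟨h0, h1⟩]; simpa using hc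
  · rw [clamp_of_ge ha h1, abs_le]; constructor <;> linarith [hx.2]

/-- Continuing a differentiable function on `[0, a]` by its tangents at the end points gives a
differentiable function on the line. -/
theorem hasDerivAt_tangent_extension {k k' : ℝ → ℝ} {a : ℝ} (ha : 0 ≤ a)
    (hk : ∀ x ∈ Icc 0 a, HasDerivWithinAt k (k' x) (Icc 0 a) x) (x : ℝ) :
    HasDerivAt (fun x => k (clamp a x) + k' (clamp a x) * (x - clamp a x)) (k' (clamp a x)) x := by
  set f : ℝ → ℝ := fun x => k (clamp a x) + k' (clamp a x) * (x - clamp a x) with hf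
  have hmid : HasDerivWithinAt f (k' (clamp a x)) (Icc 0 a) x := by
    by_cases hx : x ∈ Icc 0 a
    · rw [clamp_of_mem hx]
      exact (hk x hx).congr_of_mem (fun y hy => by simp [hf, clamp_of_mem hy]) hx
    · exact HasFDerivWithinAt.of_notMem_closure (by rwa [isClosed_Icc.closure_eq])
  have haff : ∀ c, HasDerivAt (fun x => k c + k' c * (x - c)) (k' c) x := fun c => by
    simpa using (((hasDerivAt_id x).sub_const c).const_mul (k' c)).const_add (k c)
  have hleft : HasDerivWithinAt f (k' (clamp a x)) (Iic 0) x := by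
    by_cases hx : x ∈ Iic 0
    · rw [clamp_of_nonpos ha hx]
      exact (haff 0).hasDerivWithinAt.congr_of_mem
        (fun y hy => by simp [hf, clamp_of_nonpos ha hy]) hx
    · exact HasFDerivWithinAt.of_notMem_closure (by rwa [isClosed_Iic.closure_eq])
  have hright : HasDerivWithinAt f (k' (clamp a x)) (Ici a) x := by
    by_cases hx : x ∈ Ici a
    · rw [clamp_of_ge ha hx]
      exact (haff a).hasDerivWithinAt.congr_of_mem
        (fun y hy => by simp [hf, clamp_of_ge ha hy]) hx
    · exact HasFDerivWithinAt.of_notMem_closure (by rwa [isClosed_Ici.closure_eq])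
  have hun : Iic 0 ∪ Icc 0 a ∪ Ici a = univ := by
    rw [Iic_union_Icc_eq_Iic ha, Iic_union_Ici]
  have := (hleft.union hmid).union hright
  rwa [hun, hasDerivWithinAt_univ] at this

/-- The extension of a coefficient to all `x` by tangents, and to all times by freezing the
time outside `[0, τ]`; the state variable is `z = (x, s)`. -/
noncomputable def extendCoef (ℓ T τ : ℝ) (h : ℝ × ℝ × ℝ → ℝ) (t : ℝ) (z : ℝ × ℝ) : ℝ :=
  h (z.2, clamp ℓ z.1, clamp τ t) + partialX ℓ T h (z.2, clamp ℓ z.1, clamp τ t) *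
    (z.1 - clamp ℓ z.1)

/-- The derivative of `extendCoef` in the state variable. -/
noncomputable def extendCoefDeriv (ℓ T τ : ℝ) (h : ℝ × ℝ × ℝ → ℝ) (t : ℝ) (z : ℝ × ℝ) :
    ℝ × ℝ →L[ℝ] ℝ :=
  (ContinuousLinearMap.toSpanSingleton ℝ (partialX ℓ T h (z.2, clamp ℓ z.1, clamp τ t))).coprod
    (ContinuousLinearMap.toSpanSingleton ℝ (partialS ℓ T h (z.2, clamp ℓ z.1, clamp τ t) +
      partialS ℓ T (partialX ℓ T h) (z.2, clamp ℓ z.1, clamp τ t) * (z.1 - clamp ℓ z.1)))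

variable {τ : ℝ}

theorem continuous_clamped (hℓ : 0 < ℓ) (hτ : τ ∈ Icc 0 T) {k : ℝ × ℝ × ℝ → ℝ}
    (hk : ContinuousOn k (coefDomain ℓ T)) :
    Continuous fun p : ℝ × ℝ × ℝ => k (p.2.2, clamp ℓ p.2.1, clamp τ p.1) := by
  have h1 := continuous_clamp ℓ
  have h2 := continuous_clamp τ
  refine hk.comp_continuous (by fun_prop) fun p => ⟨mem_univ _, clamp_mem hℓ.le _, ?_⟩
  exact Icc_subset_Icc_right hτ.2 (clamp_mem hτ.1 _)

theorem continuous_extendCoef (hℓ : 0 < ℓ) (hT : 0 < T) (hτ : τ ∈ Icc 0 T)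
    (hh : ContDiffOn ℝ ∞ h (coefDomain ℓ T)) :
    Continuous (Function.uncurry (extendCoef ℓ T τ h)) := by
  have h1 := continuous_clamp ℓ
  have h2 : Continuous fun p : ℝ × ℝ × ℝ => p.2.1 - clamp ℓ p.2.1 := by fun_prop
  exact (continuous_clamped hℓ hτ hh.continuousOn).add
    ((continuous_clamped hℓ hτ (contDiffOn_partialX hℓ hT hh).continuousOn).mul h2)

theorem continuous_extendCoefDeriv (hℓ : 0 < ℓ) (hT : 0 < T) (hτ : τ ∈ Icc 0 T)
    (hh : ContDiffOn ℝ ∞ h (coefDomain ℓ T)) (z : ℝ × ℝ) :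
    Continuous fun t => extendCoefDeriv ℓ T τ h t z := by
  have hc : Continuous fun x : ℝ => ContinuousLinearMap.toSpanSingleton ℝ x :=
    (ContinuousLinearMap.toSpanSingletonCLE (𝕜 := ℝ) (E := ℝ)).continuous
  have hz : Continuous fun t : ℝ => (t, z) := by fun_prop
  have hX := contDiffOn_partialX hℓ hT hh
  have h1 := (continuous_clamped hℓ hτ hX.continuousOn).comp hz
  have h2 := (continuous_clamped hℓ hτ (contDiffOn_partialS hℓ hT hh).continuousOn).comp hz
  have h3 := (continuous_clamped hℓ hτ (contDiffOn_partialS hℓ hT hX).continuousOn).comp hz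
  exact (ContinuousLinearMap.coprodEquivL (S := ℝ) (𝕜 := ℝ)).continuous.comp
    ((hc.comp h1).prodMk (hc.comp (h2.add (h3.mul continuous_const))))

theorem hasFDerivAt_extendCoef (hℓ : 0 < ℓ) (hT : 0 < T) (hτ : τ ∈ Icc 0 T)
    (hh : ContDiffOn ℝ ∞ h (coefDomain ℓ T)) (t : ℝ) (z : ℝ × ℝ) :
    HasFDerivAt (extendCoef ℓ T τ h t) (extendCoefDeriv ℓ T τ h t z) z := by
  have ht : clamp τ t ∈ Icc 0 T := Icc_subset_Icc_right hτ.2 (clamp_mem hτ.1 _)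
  have hX := contDiffOn_partialX hℓ hT hh
  have hz : Continuous fun z : ℝ × ℝ => (t, z) := by fun_prop
  have hcl := continuous_clamp ℓ
  refine (hasStrictFDerivAt_of_partial_deriv (U := univ)
    (z := fun x s => extendCoef ℓ T τ h t (x, s))
    (a := fun x s => partialX ℓ T h (s, clamp ℓ x, clamp τ t))
    (b := fun x s => partialS ℓ T h (s, clamp ℓ x, clamp τ t) +
      partialS ℓ T (partialX ℓ T h) (s, clamp ℓ x, clamp τ t) * (x - clamp ℓ x))
    isOpen_univ (fun p _ => ?_) (fun p _ => ?_) ?_ ?_ (mem_univ z)).hasFDerivAt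
  · exact hasDerivAt_tangent_extension hℓ.le
      (fun x hx => hasDerivWithinAt_partialX hh p.2 hx ht) p.1
  · exact (hasDerivAt_partialS hh p.2 (clamp_mem hℓ.le _) ht).add
      ((hasDerivAt_partialS hX p.2 (clamp_mem hℓ.le p.1) ht).mul_const (p.1 - clamp ℓ p.1))
  · exact ((continuous_clamped hℓ hτ hX.continuousOn).comp hz).continuousOn
  · exact (((continuous_clamped hℓ hτ (contDiffOn_partialS hℓ hT hh).continuousOn).comp hz).add
      (((continuous_clamped hℓ hτ (contDiffOn_partialS hℓ hT hX).continuousOn).comp hz).mul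
        (by fun_prop))).continuousOn

theorem norm_coprod_toSpanSingleton_le (a b : ℝ) :
    ‖(ContinuousLinearMap.toSpanSingleton ℝ a).coprod
      (ContinuousLinearMap.toSpanSingleton ℝ b)‖ ≤ |a| + |b| := by
  refine ContinuousLinearMap.opNorm_le_bound _ (by positivity) fun x => ?_
  have h1 : |x.1| ≤ ‖x‖ := norm_fst_le x
  have h2 : |x.2| ≤ ‖x‖ := norm_snd_le x
  calc ‖_‖ = |x.1 * a + x.2 * b| := by simp [Real.norm_eq_abs]
    _ ≤ |x.1| * |a| + |x.2| * |b| := (abs_add_le _ _).trans (by rw [abs_mul, abs_mul])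
    _ ≤ ‖x‖ * |a| + ‖x‖ * |b| := by gcongr
    _ = _ := by ring

/-- The extended coefficient has the bounds required of a `C^{1,1}` field. -/
theorem exists_bound_extendCoef (hℓ : 0 < ℓ) (hT : 0 < T) (hτ : τ ∈ Icc 0 T)
    (hh : ContDiffOn ℝ ∞ h (coefDomain ℓ T)) :
    ∃ M, 0 ≤ M ∧ ∀ t, ∀ z ∈ Icc (-2) (ℓ + 2) ×ˢ Icc (-1 : ℝ) 1,
      |extendCoef ℓ T τ h t z| ≤ M ∧ ‖extendCoefDeriv ℓ T τ h t z‖ ≤ M ∧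
      ∀ z' ∈ Icc (-2) (ℓ + 2) ×ˢ Icc (-1 : ℝ) 1,
        ‖extendCoefDeriv ℓ T τ h t z - extendCoefDeriv ℓ T τ h t z'‖ ≤ M * ‖z - z'‖ := by
  have hX := contDiffOn_partialX hℓ hT hh
  -- a bound and Lipschitz constant common to all the functions involved
  have key : ∀ {k : ℝ × ℝ × ℝ → ℝ}, ContDiffOn ℝ ∞ k (coefDomain ℓ T) →
      ∃ C, 0 ≤ C ∧ ∀ t, ∀ z ∈ Icc (-2) (ℓ + 2) ×ˢ Icc (-1 : ℝ) 1,
        |k (z.2, clamp ℓ z.1, clamp τ t)| ≤ C ∧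
        ∀ z' ∈ Icc (-2) (ℓ + 2) ×ˢ Icc (-1 : ℝ) 1,
          |k (z.2, clamp ℓ z.1, clamp τ t) - k (z'.2, clamp ℓ z'.1, clamp τ t)|
            ≤ C * ‖z - z'‖ := by
    intro k hk
    obtain ⟨C, hC0, hC1, hC2⟩ := exists_bound_lipschitz hk 1
    have hr : ∀ x t, (clamp ℓ x, clamp τ t) ∈ Icc (0 : ℝ) ℓ ×ˢ Icc (0 : ℝ) T := fun x t =>
      ⟨clamp_mem hℓ.le _, Icc_subset_Icc_right hτ.2 (clamp_mem hτ.1 _)⟩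
    refine ⟨C, hC0, fun t z hz => ⟨hC1 _ hz.2 _ (hr _ _), fun z' hz' => ?_⟩⟩
    refine (hC2 _ hz.2 _ hz'.2 _ (hr _ _) _ (hr _ _)).trans ?_
    gcongr
    refine max_le (norm_snd_le (z - z')) (max_le ?_ ?_)
    · exact (abs_clamp_sub_le _ _ _).trans (norm_fst_le (z - z'))
    · simp
  obtain ⟨C₁, h10, h1⟩ := key hh
  obtain ⟨C₂, h20, h2⟩ := key hX
  obtain ⟨C₃, h30, h3⟩ := key (contDiffOn_partialS hℓ hT hh)
  obtain ⟨C₄, h40, h4⟩ := key (contDiffOn_partialS hℓ hT hX)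
  refine ⟨C₁ + 3 * C₂ + C₃ + 4 * C₄, by positivity, fun t z hz => ⟨?_, ?_, fun z' hz' => ?_⟩⟩
  · have hx := abs_sub_clamp_le hℓ.le zero_le_two hz.1
    calc _ ≤ _ := abs_add_le _ _
      _ ≤ C₁ + C₂ * 2 := by
        rw [abs_mul]
        gcongr
        exacts [(h1 t z hz).1, (h2 t z hz).1]
      _ ≤ _ := by linarith
  · have hx := abs_sub_clamp_le hℓ.le zero_le_two hz.1
    calc _ ≤ _ := norm_coprod_toSpanSingleton_le _ _
      _ ≤ C₂ + (C₃ + C₄ * 2) := by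
        refine add_le_add (h2 t z hz).1 ((abs_add_le _ _).trans ?_)
        rw [abs_mul]
        gcongr
        exacts [(h3 t z hz).1, (h4 t z hz).1]
      _ ≤ _ := by linarith
  · have hx := abs_sub_clamp_le hℓ.le zero_le_two hz.1
    have hcl := abs_clamp_sub_le ℓ z.1 z'.1
    have hz1 : |z.1 - z'.1| ≤ ‖z - z'‖ := norm_fst_le (z - z')
    have e : extendCoefDeriv ℓ T τ h t z - extendCoefDeriv ℓ T τ h t z'
        = (ContinuousLinearMap.toSpanSingleton ℝ
            (partialX ℓ T h (z.2, clamp ℓ z.1, clamp τ t)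
              - partialX ℓ T h (z'.2, clamp ℓ z'.1, clamp τ t))).coprod
          (ContinuousLinearMap.toSpanSingleton ℝ
            ((partialS ℓ T h (z.2, clamp ℓ z.1, clamp τ t)
              - partialS ℓ T h (z'.2, clamp ℓ z'.1, clamp τ t))
            + ((partialS ℓ T (partialX ℓ T h) (z.2, clamp ℓ z.1, clamp τ t)
              - partialS ℓ T (partialX ℓ T h) (z'.2, clamp ℓ z'.1, clamp τ t))
                * (z.1 - clamp ℓ z.1)
              + partialS ℓ T (partialX ℓ T h) (z'.2, clamp ℓ z'.1, clamp τ t)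
                * ((z.1 - z'.1) - (clamp ℓ z.1 - clamp ℓ z'.1))))) := by
      ext
      · simp [extendCoefDeriv]
      · simp [extendCoefDeriv]; ring
    rw [e]
    have hsub : |(z.1 - z'.1) - (clamp ℓ z.1 - clamp ℓ z'.1)| ≤ 2 * ‖z - z'‖ :=
      (abs_sub _ _).trans (by linarith)
    calc _ ≤ _ := norm_coprod_toSpanSingleton_le _ _
      _ ≤ C₂ * ‖z - z'‖ + (C₃ * ‖z - z'‖ + (C₄ * ‖z - z'‖ * 2 + C₄ * (2 * ‖z - z'‖))) := by
        refine add_le_add ((h2 t z hz).2 z' hz') ((abs_add_le _ _).trans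
          (add_le_add ((h3 t z hz).2 z' hz') ((abs_add_le _ _).trans ?_)))
        rw [abs_mul, abs_mul]
        gcongr
        exacts [(h4 t z hz).2 z' hz', (h4 t z' hz').1]
      _ = (C₂ + C₃ + 4 * C₄) * ‖z - z'‖ := by ring
      _ ≤ _ := by gcongr; linarith

/-- The extensions of two smooth coefficients form a `C^{1,1}` field. -/
theorem exists_isC11Field_extendCoef (hℓ : 0 < ℓ) (hT : 0 < T) (hτ : τ ∈ Icc 0 T)
    {a g : ℝ × ℝ × ℝ → ℝ} (ha : ContDiffOn ℝ ∞ a (coefDomain ℓ T))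
    (hg : ContDiffOn ℝ ∞ g (coefDomain ℓ T)) :
    ∃ M, 0 ≤ M ∧ IsC11Field (fun t z => (extendCoef ℓ T τ a t z, extendCoef ℓ T τ g t z))
      (fun t z => (extendCoefDeriv ℓ T τ a t z).prod (extendCoefDeriv ℓ T τ g t z))
      (Icc (-2) (ℓ + 2) ×ˢ Icc (-1) 1) M := by
  obtain ⟨M₁, h10, h1⟩ := exists_bound_extendCoef hℓ hT hτ ha
  obtain ⟨M₂, h20, h2⟩ := exists_bound_extendCoef hℓ hT hτ hg
  refine ⟨max M₁ M₂, le_max_of_le_left h10, ⟨?_, fun z => ?_, fun t z _ => ?_, fun t z hz => ?_,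
    fun t z hz => ?_, fun t z hz z' hz' => ?_⟩⟩
  · exact (continuous_extendCoef hℓ hT hτ ha).prodMk (continuous_extendCoef hℓ hT hτ hg)
  · exact (ContinuousLinearMap.prodₗᵢ ℝ).continuous.comp
      ((continuous_extendCoefDeriv hℓ hT hτ ha z).prodMk (continuous_extendCoefDeriv hℓ hT hτ hg z))
  · exact (hasFDerivAt_extendCoef hℓ hT hτ ha t z).prodMk
      (hasFDerivAt_extendCoef hℓ hT hτ hg t z)
  · exact max_le_max (h1 t z hz).1 (h2 t z hz).1
  · rw [ContinuousLinearMap.opNorm_prod]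
    exact max_le_max (h1 t z hz).2.1 (h2 t z hz).2.1
  · have e : (extendCoefDeriv ℓ T τ a t z).prod (extendCoefDeriv ℓ T τ g t z)
        - (extendCoefDeriv ℓ T τ a t z').prod (extendCoefDeriv ℓ T τ g t z')
        = (extendCoefDeriv ℓ T τ a t z - extendCoefDeriv ℓ T τ a t z').prod
          (extendCoefDeriv ℓ T τ g t z - extendCoefDeriv ℓ T τ g t z') := rfl
    rw [e, ContinuousLinearMap.opNorm_prod]
    refine max_le (((h1 t z hz).2.2 z' hz').trans ?_) (((h2 t z hz).2.2 z' hz').trans ?_)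
    · gcongr; exact le_max_left _ _
    · gcongr; exact le_max_right _ _

end Coefficients

/-! ### The maximum principle and the equation up to the boundary -/

section MaximumPrinciple

variable {ℓ T₁ : ℝ}

theorem uniqueDiffOn_rectangle (hℓ : 0 < ℓ) (hT₁ : 0 < T₁) :
    UniqueDiffOn ℝ (Icc 0 ℓ ×ˢ Icc 0 T₁ : Set (ℝ × ℝ)) :=
  (uniqueDiffOn_Icc hℓ).prod (uniqueDiffOn_Icc hT₁)

/-- At a maximum point over a convex set the derivative in the direction of another point of the
set is nonpositive. -/
theorem IsMaxOn.hasFDerivWithinAt_sub_nonpos {E : Type*} [NormedAddCommGroup E] [NormedSpace ℝ E]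
    {S : Set E} {f : E → ℝ} {f' : E →L[ℝ] ℝ} {p q : E} (hmax : IsMaxOn f S p) (hS : Convex ℝ S)
    (hf : HasFDerivWithinAt f f' S p) (hp : p ∈ S) (hq : q ∈ S) : f' (q - p) ≤ 0 :=
  IsLocalMaxOn.hasFDerivWithinAt_nonpos hmax.localize hf
    (sub_mem_posTangentConeAt_of_segment_subset (hS.segment_subset hp hq))

/-- A maximum principle for transport inequalities. Data are prescribed at `t = 0` and at `x = 0`;
no datum is needed at `x = ℓ`, where the transport is outgoing. -/
theorem nonpos_of_transport_inequality (hT₁ : 0 < T₁) {z b : ℝ × ℝ → ℝ}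
    {z' : ℝ × ℝ → ℝ × ℝ →L[ℝ] ℝ} {K : ℝ}
    (hz : ∀ p ∈ Icc 0 ℓ ×ˢ Icc 0 T₁, HasFDerivWithinAt z (z' p) (Icc 0 ℓ ×ˢ Icc 0 T₁) p)
    (hb : ∀ t ∈ Icc 0 T₁, 0 ≤ b (ℓ, t))
    (hz_left : ∀ t ∈ Icc 0 T₁, z (0, t) ≤ 0) (hz_init : ∀ x ∈ Icc 0 ℓ, z (x, 0) ≤ 0)
    (hineq : ∀ p ∈ Icc 0 ℓ ×ˢ Icc 0 T₁, 0 < z p →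
      z' p (0, 1) + b p * z' p (1, 0) ≤ K * z p) :
    ∀ p ∈ Icc 0 ℓ ×ˢ Icc 0 T₁, z p ≤ 0 := by
  intro p₁ hp₁
  by_contra! hpos
  set R : Set (ℝ × ℝ) := Icc 0 ℓ ×ˢ Icc 0 T₁ with hR
  have hRconv : Convex ℝ R := (convex_Icc _ _).prod (convex_Icc _ _)
  -- at a positive maximum of `e^{-(K+1)t} z` the derivatives of `z` contradict the inequality
  set ζ : ℝ × ℝ → ℝ := fun p => Real.exp (-(K + 1) * p.2) * z p with hζ
  have hζd : ∀ p ∈ R, HasFDerivWithinAt ζ (Real.exp (-(K + 1) * p.2) • z' p +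
      z p • (Real.exp (-(K + 1) * p.2) • (-(K + 1)) • ContinuousLinearMap.snd ℝ ℝ ℝ)) R p :=
    fun p hp => ((hasFDerivAt_snd.const_mul (-(K + 1))).exp.hasFDerivWithinAt).mul (hz p hp)
  obtain ⟨⟨x, t⟩, hp, hmax⟩ := (isCompact_Icc.prod isCompact_Icc : IsCompact R).exists_isMaxOn
    ⟨p₁, hp₁⟩ fun p hp => (hζd p hp).continuousWithinAt
  have hzp : 0 < z (x, t) := by
    have h1 : ζ p₁ ≤ ζ (x, t) := hmax hp₁
    have h2 : 0 < ζ p₁ := mul_pos (Real.exp_pos _) hpos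
    exact (mul_pos_iff_of_pos_left (Real.exp_pos _)).1 (h2.trans_le h1)
  have hx0 : 0 < x := hp.1.1.lt_of_ne fun h => by
    subst h; exact (hz_left t hp.2).not_gt hzp
  have ht0 : 0 < t := hp.2.1.lt_of_ne fun h => by
    subst h; exact (hz_init x hp.1).not_gt hzp
  have hexp := Real.exp_pos (-(K + 1) * t)
  have hdir : ∀ q ∈ R, (q.1 - x) * z' (x, t) (1, 0)
      + (q.2 - t) * (z' (x, t) (0, 1) - (K + 1) * z (x, t)) ≤ 0 := fun q hq => by
    have h1 := hmax.hasFDerivWithinAt_sub_nonpos hRconv (hζd _ hp) hp hq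
    have h2 : q - (x, t) = (q.1 - x) • ((1, 0) : ℝ × ℝ) + (q.2 - t) • ((0, 1) : ℝ × ℝ) := by
      ext <;> simp
    rw [h2] at h1
    simp only [map_add, map_smul] at h1
    simp only [smul_eq_mul, add_apply, smul_apply,
      ContinuousLinearMap.coe_snd', mul_zero, add_zero, mul_one] at h1
    refine le_of_mul_le_mul_left ?_ hexp
    linarith
  have hzt : 0 ≤ z' (x, t) (0, 1) - (K + 1) * z (x, t) := by
    have := hdir (x, 0) ⟨hp.1, le_rfl, hT₁.le⟩
    simp only [sub_self, zero_mul, zero_add, zero_sub] at this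
    nlinarith
  have hzx : 0 ≤ z' (x, t) (1, 0) := by
    have := hdir (0, t) ⟨⟨le_rfl, hx0.le.trans hp.1.2⟩, hp.2⟩
    simp only [sub_self, zero_mul, add_zero, zero_sub] at this
    nlinarith
  have hbz : 0 ≤ b (x, t) * z' (x, t) (1, 0) := by
    rcases hp.1.2.eq_or_lt with h | h
    · simp only at h
      rw [h] at hzx ⊢
      exact mul_nonneg (hb t hp.2) hzx
    · have := hdir (ℓ, t) ⟨⟨hx0.le.trans hp.1.2, le_rfl⟩, hp.2⟩
      simp only [sub_self, zero_mul, add_zero] at this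
      have hzx0 : z' (x, t) (1, 0) = 0 := le_antisymm (by nlinarith) hzx
      rw [hzx0, mul_zero]
  linarith [hineq _ hp hzp]

end MaximumPrinciple

/-- The characteristic speed `∂_s (s v) = v + s ∂_s v`. -/
noncomputable def charSpeed (ℓ T : ℝ) (v : ℝ → ℝ → ℝ → ℝ) (p : ℝ × ℝ × ℝ) : ℝ :=
  v p.1 p.2.1 p.2.2 + p.1 * partialS ℓ T (fun p => v p.1 p.2.1 p.2.2) p

/-- The right-hand side `- φ̂ - s ∂_x v` of the equation in nonconservative form. -/
noncomputable def charSource (ℓ T : ℝ) (ϖ : Set Plane) (v : ℝ → ℝ → ℝ → ℝ)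
    (φ : ℝ → ℝ → Plane → ℝ → ℝ) (p : ℝ × ℝ × ℝ) : ℝ :=
  - phiHat ϖ φ p.1 p.2.1 p.2.2 - p.1 * partialX ℓ T (fun p => v p.1 p.2.1 p.2.2) p

section Solutions

variable {ℓ T T₁ δ₁ : ℝ} {ϖ : Set Plane} {v : ℝ → ℝ → ℝ → ℝ} {φ : ℝ → ℝ → Plane → ℝ → ℝ}
  {w w₁ w₂ : ℝ → ℝ → ℝ}

theorem VelocityAssumption.contDiffOn_charSpeed (hℓ : 0 < ℓ) (hT : 0 < T)
    (hv : VelocityAssumption ℓ T δ₁ v) :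
    ContDiffOn ℝ ∞ (charSpeed ℓ T v) (coefDomain ℓ T) :=
  hv.smooth.add (contDiffOn_fst.mul (contDiffOn_partialS hℓ hT hv.smooth))

theorem contDiffOn_charSource (hℓ : 0 < ℓ) (hT : 0 < T) (hϖ : IsCrossSection ϖ)
    (hv : VelocityAssumption ℓ T δ₁ v) (hφ : InteractionAssumption ℓ T δ₁ ϖ φ) :
    ContDiffOn ℝ ∞ (charSource ℓ T ϖ v φ) (coefDomain ℓ T) :=
  (hφ.contDiffOn_phiHat hℓ hT hϖ).neg.sub
    (contDiffOn_fst.mul (contDiffOn_partialX hℓ hT hv.smooth))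

theorem VelocityAssumption.charSpeed_right_nonneg (hℓ : 0 < ℓ) (hδ₁ : 0 < δ₁)
    (hv : VelocityAssumption ℓ T δ₁ v) (s : ℝ) {t : ℝ} (ht : t ∈ Icc 0 T) :
    0 ≤ charSpeed ℓ T v (s, ℓ, t) := by
  obtain ⟨vbar, ς₀, hς₀, h⟩ := hv.right_end
  have hℓmem : ℓ ∈ Icc 0 ℓ ∩ Icc (ℓ - δ₁) ℓ := ⟨⟨hℓ.le, le_rfl⟩, by linarith, le_rfl⟩
  have hd := hasDerivAt_partialS hv.smooth s hℓmem.1 ht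
  have hc : (fun s => v s ℓ t) = fun _ => vbar t := funext fun s => (h s ℓ hℓmem t ht).1
  simp only [hc] at hd
  have h0 := hd.unique (hasDerivAt_const s (vbar t))
  have h1 := h s ℓ hℓmem t ht
  simp only [charSpeed, h0, mul_zero, add_zero]
  linarith [h1.1, h1.2]

theorem phiHat_eq_zero {s x t : ℝ} (h : ∀ ξ ∈ closure ϖ, φ s x ξ t = 0) :
    phiHat ϖ φ s x t = 0 := by
  rw [phiHat, setIntegral_eq_zero_of_forall_eq_zero fun ξ hξ => h ξ (frontier_subset_closure hξ),
    mul_zero]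

theorem partialX_eq_zero_of_const {h : ℝ × ℝ × ℝ → ℝ}
    (hh : ContDiffOn ℝ ∞ h (coefDomain ℓ T)) {d s x t c : ℝ} (hd : 0 < d) (hdℓ : d ≤ ℓ)
    (ht : t ∈ Icc 0 T) (hc : ∀ y ∈ Icc 0 d, h (s, y, t) = c) (hx : x ∈ Icc 0 d) :
    partialX ℓ T h (s, x, t) = 0 := by
  have hsub : Icc 0 d ⊆ Icc 0 ℓ := Icc_subset_Icc_right hdℓ
  have h1 := (hasDerivWithinAt_partialX hh s (hsub hx) ht).mono hsub
  have h2 : HasDerivWithinAt (fun y => h (s, y, t)) 0 (Icc 0 d) x :=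
    (hasDerivWithinAt_const x _ c).congr_of_mem (fun y hy => hc y hy) hx
  exact (uniqueDiffOn_Icc hd x hx).eq_deriv _ h1 h2

/-- Near the left end and for small times there is no source. -/
theorem charSource_left_eq_zero (hℓ : 0 < ℓ) (hδ₁ : 0 < δ₁)
    (hv : VelocityAssumption ℓ T δ₁ v) (hφ : InteractionAssumption ℓ T δ₁ ϖ φ) (s : ℝ) {x t : ℝ}
    (hx : x ∈ Icc 0 (min δ₁ ℓ)) (ht : t ∈ Icc 0 (min T δ₁)) :
    charSource ℓ T ϖ v φ (s, x, t) = 0 := by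
  have hd : 0 < min δ₁ ℓ := lt_min hδ₁ hℓ
  have hmem : ∀ y ∈ Icc 0 (min δ₁ ℓ), y ∈ Icc 0 ℓ ∩ Icc 0 δ₁ := fun y hy =>
    ⟨⟨hy.1, hy.2.trans (min_le_right _ _)⟩, hy.1, hy.2.trans (min_le_left _ _)⟩
  have htT : t ∈ Icc 0 T ∩ Icc 0 δ₁ :=
    ⟨⟨ht.1, ht.2.trans (min_le_left _ _)⟩, ht.1, ht.2.trans (min_le_right _ _)⟩
  have h1 := partialX_eq_zero_of_const hv.smooth (s := s) hd (min_le_right _ _) htT.1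
    (fun y hy => hv.indep_left s y (hmem y hy) 0 (hmem 0 ⟨le_rfl, hd.le⟩) t htT) hx
  have h2 : phiHat ϖ φ s x t = 0 :=
    phiHat_eq_zero fun ξ hξ => hφ.vanish_left s x (hmem x hx) ξ hξ t htT.1
  simp [charSource, h1, h2]

/-- At interior points the conservative form of the equation agrees with the nonconservative one. -/
theorem conservative_iff_nonconservative (hv : VelocityAssumption ℓ T δ₁ v) (hT₁T : T₁ ≤ T)
    (hw : ContDiffOn ℝ 1 (fun p : ℝ × ℝ => w p.1 p.2) (Icc 0 ℓ ×ˢ Icc 0 T₁)) {x t : ℝ}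
    (hx : x ∈ Ioo 0 ℓ) (ht : t ∈ Ioo 0 T₁) :
    deriv (fun τ => w x τ) t + deriv (fun y => v (w y t) y t * w y t) x
        = - phiHat ϖ φ (w x t) x t ↔
      fderivWithin ℝ (fun p : ℝ × ℝ => w p.1 p.2) (Icc 0 ℓ ×ˢ Icc 0 T₁) (x, t) (0, 1)
        + charSpeed ℓ T v (w x t, x, t) *
          fderivWithin ℝ (fun p : ℝ × ℝ => w p.1 p.2) (Icc 0 ℓ ×ˢ Icc 0 T₁) (x, t) (1, 0)
        = charSource ℓ T ϖ v φ (w x t, x, t) := by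
  set L := fderivWithin ℝ (fun p : ℝ × ℝ => w p.1 p.2) (Icc 0 ℓ ×ˢ Icc 0 T₁) (x, t) with hL
  have hD : HasFDerivAt (fun p : ℝ × ℝ => w p.1 p.2) L (x, t) :=
    ((hw (x, t) ⟨Ioo_subset_Icc_self hx, Ioo_subset_Icc_self ht⟩).differentiableWithinAt
      one_ne_zero).hasFDerivWithinAt.hasFDerivAt
      (prod_mem_nhds (Icc_mem_nhds hx.1 hx.2) (Icc_mem_nhds ht.1 ht.2))
  have hwt : HasDerivAt (fun τ => w x τ) (L (0, 1)) t :=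
    hD.comp_hasDerivAt (f := fun τ => (x, τ)) t ((hasDerivAt_const t x).prodMk (hasDerivAt_id t))
  have hwx : HasDerivAt (fun y => w y t) (L (1, 0)) x :=
    hD.comp_hasDerivAt (f := fun y => (y, t)) x ((hasDerivAt_id x).prodMk (hasDerivAt_const x t))
  have htT : t ∈ Ioo 0 T := ⟨ht.1, ht.2.trans_le hT₁T⟩
  have hV : HasFDerivAt (fun p : ℝ × ℝ × ℝ => v p.1 p.2.1 p.2.2) _ (w x t, x, t) :=
    ((hv.smooth _ ⟨mem_univ _, Ioo_subset_Icc_self hx,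
      Ioo_subset_Icc_self htT⟩).differentiableWithinAt (by simp)).hasFDerivWithinAt.hasFDerivAt
      (prod_mem_nhds Filter.univ_mem (prod_mem_nhds (Icc_mem_nhds hx.1 hx.2)
        (Icc_mem_nhds htT.1 htT.2)))
  have hcurve : HasDerivAt (fun y => (w y t, y, t)) (L (1, 0), 1, 0) x :=
    hwx.prodMk ((hasDerivAt_id x).prodMk (hasDerivAt_const x t))
  have hflux := (hV.comp_hasDerivAt x hcurve).mul hwx
  have hsplit : ((L (1, 0), 1, 0) : ℝ × ℝ × ℝ) = L (1, 0) • (1, 0, 0) + (0, 1, 0) := by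
    ext <;> simp
  rw [hsplit, map_add, map_smul] at hflux
  rw [hwt.deriv, (show deriv (fun y => v (w y t) y t * w y t) x = _ from hflux.deriv)]
  simp only [charSpeed, charSource, partialS, partialX, coefDomain, Function.comp, smul_eq_mul]
  constructor <;> intro h <;> linear_combination h

/-- A classical solution satisfies the nonconservative equation up to the boundary. -/
theorem IsClassicalSolution.nonconservative (hℓ : 0 < ℓ) (hT : 0 < T) (hT₁ : 0 < T₁)
    (hT₁T : T₁ ≤ T) (hϖ : IsCrossSection ϖ) (hv : VelocityAssumption ℓ T δ₁ v)
    (hφ : InteractionAssumption ℓ T δ₁ ϖ φ) (hw : IsClassicalSolution ℓ T₁ ϖ v φ w) :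
    ∀ p ∈ Icc 0 ℓ ×ˢ Icc 0 T₁,
      fderivWithin ℝ (fun p : ℝ × ℝ => w p.1 p.2) (Icc 0 ℓ ×ˢ Icc 0 T₁) p (0, 1)
        + charSpeed ℓ T v (w p.1 p.2, p.1, p.2) *
          fderivWithin ℝ (fun p : ℝ × ℝ => w p.1 p.2) (Icc 0 ℓ ×ˢ Icc 0 T₁) p (1, 0)
        = charSource ℓ T ϖ v φ (w p.1 p.2, p.1, p.2) := by
  have hmaps : MapsTo (fun p : ℝ × ℝ => (w p.1 p.2, p.1, p.2)) (Icc 0 ℓ ×ˢ Icc 0 T₁)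
      (coefDomain ℓ T) := fun p hp => ⟨mem_univ _, hp.1, hp.2.1, hp.2.2.trans hT₁T⟩
  have hc : ContinuousOn (fun p : ℝ × ℝ => (w p.1 p.2, p.1, p.2)) (Icc 0 ℓ ×ˢ Icc 0 T₁) :=
    hw.contDiffOn.continuousOn.prodMk continuousOn_id
  have hD := hw.contDiffOn.continuousOn_fderivWithin (uniqueDiffOn_rectangle hℓ hT₁) le_rfl
  have hint : EqOn (fun p : ℝ × ℝ =>
      fderivWithin ℝ (fun p : ℝ × ℝ => w p.1 p.2) (Icc 0 ℓ ×ˢ Icc 0 T₁) p (0, 1)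
        + charSpeed ℓ T v (w p.1 p.2, p.1, p.2) *
          fderivWithin ℝ (fun p : ℝ × ℝ => w p.1 p.2) (Icc 0 ℓ ×ˢ Icc 0 T₁) p (1, 0))
      (fun p => charSource ℓ T ϖ v φ (w p.1 p.2, p.1, p.2)) (Ioo 0 ℓ ×ˢ Ioo 0 T₁) := fun p hp =>
    (conservative_iff_nonconservative hv hT₁T hw.contDiffOn hp.1 hp.2).1
      (hw.equation p.1 hp.1 p.2 hp.2)
  refine hint.of_subset_closure (t := Icc 0 ℓ ×ˢ Icc 0 T₁) ?_ ?_
    (prod_mono Ioo_subset_Icc_self Ioo_subset_Icc_self) ?_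
  · exact (hD.clm_apply continuousOn_const).add
      (((hv.contDiffOn_charSpeed hℓ hT).continuousOn.comp hc hmaps).mul
        (hD.clm_apply continuousOn_const))
  · exact (contDiffOn_charSource hℓ hT hϖ hv hφ).continuousOn.comp hc hmaps
  · rw [closure_prod_eq, closure_Ioo hℓ.ne, closure_Ioo hT₁.ne]

theorem IsClassicalSolution.hasFDerivWithinAt (hw : IsClassicalSolution ℓ T₁ ϖ v φ w) {p : ℝ × ℝ}
    (hp : p ∈ Icc 0 ℓ ×ˢ Icc 0 T₁) :
    HasFDerivWithinAt (fun p : ℝ × ℝ => w p.1 p.2)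
      (fderivWithin ℝ (fun p : ℝ × ℝ => w p.1 p.2) (Icc 0 ℓ ×ˢ Icc 0 T₁) p)
      (Icc 0 ℓ ×ˢ Icc 0 T₁) p :=
  ((hw.contDiffOn p hp).differentiableWithinAt one_ne_zero).hasFDerivWithinAt

theorem IsClassicalSolution.exists_bound (hw : IsClassicalSolution ℓ T₁ ϖ v φ w) :
    ∃ N, ∀ p ∈ Icc 0 ℓ ×ˢ Icc 0 T₁, |w p.1 p.2| ≤ N :=
  (isCompact_Icc.prod isCompact_Icc).exists_bound_of_continuousOn hw.contDiffOn.continuousOn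

/-- Comparison of classical solutions: the difference of two solutions satisfies a linear transport
inequality. -/
theorem IsClassicalSolution.le (hℓ : 0 < ℓ) (hT : 0 < T) (hδ₁ : 0 < δ₁) (hT₁ : 0 < T₁)
    (hT₁T : T₁ ≤ T) (hϖ : IsCrossSection ϖ) (hv : VelocityAssumption ℓ T δ₁ v)
    (hφ : InteractionAssumption ℓ T δ₁ ϖ φ) (hw₁ : IsClassicalSolution ℓ T₁ ϖ v φ w₁)
    (hw₂ : IsClassicalSolution ℓ T₁ ϖ v φ w₂) :
    ∀ x ∈ Icc 0 ℓ, ∀ t ∈ Icc 0 T₁, w₁ x t ≤ w₂ x t := by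
  obtain ⟨N₁, hN₁⟩ := hw₁.exists_bound
  obtain ⟨N₂, hN₂⟩ := hw₂.exists_bound
  obtain ⟨A, hA0, -, hA⟩ := exists_bound_lipschitz (hv.contDiffOn_charSpeed hℓ hT) (max N₁ N₂)
  obtain ⟨C, hC0, -, hC⟩ :=
    exists_bound_lipschitz (contDiffOn_charSource hℓ hT hϖ hv hφ) (max N₁ N₂)
  obtain ⟨D, hD⟩ := (isCompact_Icc.prod isCompact_Icc).exists_bound_of_continuousOn
    ((hw₁.contDiffOn.continuousOn_fderivWithin (uniqueDiffOn_rectangle hℓ hT₁) le_rfl).clm_apply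
      (continuousOn_const (c := ((1, 0) : ℝ × ℝ))))
  have hmem₁ : ∀ p ∈ Icc 0 ℓ ×ˢ Icc 0 T₁, w₁ p.1 p.2 ∈ Icc (-max N₁ N₂) (max N₁ N₂) :=
    fun p hp => abs_le.1 ((hN₁ p hp).trans (le_max_left _ _))
  have hmem₂ : ∀ p ∈ Icc 0 ℓ ×ˢ Icc 0 T₁, w₂ p.1 p.2 ∈ Icc (-max N₁ N₂) (max N₁ N₂) :=
    fun p hp => abs_le.1 ((hN₂ p hp).trans (le_max_right _ _))
  have key := nonpos_of_transport_inequality hT₁ (K := C + A * D)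
    (z := fun p => w₁ p.1 p.2 - w₂ p.1 p.2)
    (b := fun p => charSpeed ℓ T v (w₂ p.1 p.2, p.1, p.2))
    (fun p hp => (hw₁.hasFDerivWithinAt hp).sub (hw₂.hasFDerivWithinAt hp))
    (fun t ht => hv.charSpeed_right_nonneg hℓ hδ₁ _ ⟨ht.1, ht.2.trans hT₁T⟩)
    (fun t ht => by simp [hw₁.boundary t ht, hw₂.boundary t ht])
    (fun x hx => by simp [hw₁.initial x hx, hw₂.initial x hx]) fun p hp hpos => ?_
  · exact fun x hx t ht => sub_nonpos.1 (key (x, t) ⟨hx, ht⟩)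
  · have hr : ((p.1, p.2) : ℝ × ℝ) ∈ Icc (0 : ℝ) ℓ ×ˢ Icc (0 : ℝ) T :=
      ⟨hp.1, hp.2.1, hp.2.2.trans hT₁T⟩
    have hnorm : ‖((w₁ p.1 p.2, p.1, p.2) : ℝ × ℝ × ℝ) - (w₂ p.1 p.2, p.1, p.2)‖
        = w₁ p.1 p.2 - w₂ p.1 p.2 := by
      simp [Prod.norm_def, abs_of_pos hpos, (sub_pos.1 hpos).le]
    have h1 := hA _ (hmem₁ p hp) _ (hmem₂ p hp) _ hr _ hr
    have h2 := hC _ (hmem₁ p hp) _ (hmem₂ p hp) _ hr _ hr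
    rw [hnorm] at h1 h2
    have e₁ := hw₁.nonconservative hℓ hT hT₁ hT₁T hϖ hv hφ p hp
    have e₂ := hw₂.nonconservative hℓ hT hT₁ hT₁T hϖ hv hφ p hp
    have h3 := hD p hp
    rw [Real.norm_eq_abs] at h3
    simp only [sub_apply]
    set a₁ := charSpeed ℓ T v (w₁ p.1 p.2, p.1, p.2)
    set a₂ := charSpeed ℓ T v (w₂ p.1 p.2, p.1, p.2)
    set L₁ := fderivWithin ℝ (fun p : ℝ × ℝ => w₁ p.1 p.2) (Icc 0 ℓ ×ˢ Icc 0 T₁) p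
    have h4 : -((a₁ - a₂) * L₁ (1, 0)) ≤ A * (w₁ p.1 p.2 - w₂ p.1 p.2) * D :=
      (neg_le_abs _).trans (by
        rw [abs_mul]
        gcongr)
    linarith [(abs_le.1 h2).2]

/-- A classical solution is nonnegative, because the source is nonnegative at `s = 0`. -/
theorem IsClassicalSolution.nonneg (hℓ : 0 < ℓ) (hT : 0 < T) (hδ₁ : 0 < δ₁) (hT₁ : 0 < T₁)
    (hT₁T : T₁ ≤ T) (hϖ : IsCrossSection ϖ) (hv : VelocityAssumption ℓ T δ₁ v)
    (hφ : InteractionAssumption ℓ T δ₁ ϖ φ)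
    (hsign : ∀ x ∈ Icc 0 ℓ, ∀ t ∈ Icc 0 T, phiHat ϖ φ 0 x t ≤ 0)
    (hw : IsClassicalSolution ℓ T₁ ϖ v φ w) :
    ∀ x ∈ Icc 0 ℓ, ∀ t ∈ Icc 0 T₁, 0 ≤ w x t := by
  obtain ⟨N, hN⟩ := hw.exists_bound
  obtain ⟨C, hC0, -, hC⟩ := exists_bound_lipschitz (contDiffOn_charSource hℓ hT hϖ hv hφ) N
  have key := nonpos_of_transport_inequality hT₁ (K := C) (z := fun p => -w p.1 p.2)
    (b := fun p => charSpeed ℓ T v (w p.1 p.2, p.1, p.2))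
    (fun p hp => (hw.hasFDerivWithinAt hp).neg)
    (fun t ht => hv.charSpeed_right_nonneg hℓ hδ₁ _ ⟨ht.1, ht.2.trans hT₁T⟩)
    (fun t ht => by simp [hw.boundary t ht]) (fun x hx => by simp [hw.initial x hx])
    fun p hp hpos => ?_
  · exact fun x hx t ht => neg_nonpos.1 (key (x, t) ⟨hx, ht⟩)
  · have htT : p.2 ∈ Icc 0 T := ⟨hp.2.1, hp.2.2.trans hT₁T⟩
    have hr : ((p.1, p.2) : ℝ × ℝ) ∈ Icc (0 : ℝ) ℓ ×ˢ Icc (0 : ℝ) T := ⟨hp.1, htT⟩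
    have hN0 : 0 ≤ N := (abs_nonneg _).trans (hN p hp)
    have h1 := hC _ (abs_le.1 (hN p hp)) 0 ⟨by linarith, hN0⟩ _ hr _ hr
    have hnorm : ‖((w p.1 p.2, p.1, p.2) : ℝ × ℝ × ℝ) - (0, p.1, p.2)‖ = -w p.1 p.2 := by
      simp only [Prod.norm_def, Prod.fst_sub, Prod.snd_sub, sub_self, norm_zero, sub_zero,
        Real.norm_eq_abs]
      rw [abs_of_neg (by linarith), max_eq_left hpos.le]
    rw [hnorm] at h1
    have h0 : 0 ≤ charSource ℓ T ϖ v φ (0, p.1, p.2) := by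
      simpa [charSource] using hsign p.1 hp.1 p.2 htT
    have e := hw.nonconservative hℓ hT hT₁ hT₁T hϖ hv hφ p hp
    simp only [neg_apply]
    linarith [(abs_le.1 h1).1]

/-- The time derivative of a classical solution vanishes initially if the interaction does. -/
theorem IsClassicalSolution.hasDerivWithinAt_time_zero (hℓ : 0 < ℓ) (hT : 0 < T) (hT₁ : 0 < T₁)
    (hT₁T : T₁ ≤ T) (hϖ : IsCrossSection ϖ) (hv : VelocityAssumption ℓ T δ₁ v)
    (hφ : InteractionAssumption ℓ T δ₁ ϖ φ)
    (hφ₀ : ∀ x ∈ Icc 0 ℓ, ∀ ξ ∈ closure ϖ, φ 0 x ξ 0 = 0)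
    (hw : IsClassicalSolution ℓ T₁ ϖ v φ w) {x : ℝ} (hx : x ∈ Icc 0 ℓ) :
    HasDerivWithinAt (fun τ => w x τ) 0 (Icc 0 T₁) 0 := by
  have h0 : (0 : ℝ) ∈ Icc 0 T₁ := ⟨le_rfl, hT₁.le⟩
  have hD := hw.hasFDerivWithinAt (p := (x, 0)) ⟨hx, h0⟩
  set L := fderivWithin ℝ (fun p : ℝ × ℝ => w p.1 p.2) (Icc 0 ℓ ×ˢ Icc 0 T₁) (x, 0) with hL
  have hwt : HasDerivWithinAt (fun τ => w x τ) (L (0, 1)) (Icc 0 T₁) 0 :=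
    hD.comp_hasDerivWithinAt (t := Icc 0 ℓ ×ˢ Icc 0 T₁) (f := fun τ => (x, τ)) 0
      ((hasDerivWithinAt_const 0 _ x).prodMk (hasDerivWithinAt_id 0 _)) fun τ hτ => ⟨hx, hτ⟩
  have hwx : HasDerivWithinAt (fun y => w y 0) (L (1, 0)) (Icc 0 ℓ) x :=
    hD.comp_hasDerivWithinAt (t := Icc 0 ℓ ×ˢ Icc 0 T₁) (f := fun y => (y, (0 : ℝ))) x
      ((hasDerivWithinAt_id x _).prodMk (hasDerivWithinAt_const x _ 0)) fun y hy => ⟨hy, h0⟩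
  have hL1 : L (1, 0) = 0 := (uniqueDiffOn_Icc hℓ x hx).eq_deriv _ hwx
    ((hasDerivWithinAt_const x _ 0).congr_of_mem (fun y hy => hw.initial y hy) hx)
  have e := hw.nonconservative hℓ hT hT₁ hT₁T hϖ hv hφ (x, 0) ⟨hx, h0⟩
  simp only [← hL, hL1, mul_zero, add_zero, hw.initial x hx, charSource,
    phiHat_eq_zero (hφ₀ x hx), zero_mul, neg_zero, sub_zero] at e
  rwa [e] at hwt

end Solutions

/-! ### Existence for a short time -/

theorem extendCoef_of_mem {ℓ T τ : ℝ} {h : ℝ × ℝ × ℝ → ℝ} {t : ℝ} {z : ℝ × ℝ}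
    (hz : z.1 ∈ Icc 0 ℓ) (ht : t ∈ Icc 0 τ) : extendCoef ℓ T τ h t z = h (z.2, z.1, t) := by
  rw [extendCoef, clamp_of_mem hz, clamp_of_mem ht, sub_self, mul_zero, add_zero]

/-- Existence of a classical solution for a short time. -/
theorem exists_isClassicalSolution {ℓ T δ₁ : ℝ} (hℓ : 0 < ℓ) (hT : 0 < T) (hδ₁ : 0 < δ₁)
    {ϖ : Set Plane} (hϖ : IsCrossSection ϖ) {v : ℝ → ℝ → ℝ → ℝ} {φ : ℝ → ℝ → Plane → ℝ → ℝ}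
    (hv : VelocityAssumption ℓ T δ₁ v) (hφ : InteractionAssumption ℓ T δ₁ ϖ φ) :
    ∃ T₁ ∈ Ioc 0 T, ∃ w : ℝ → ℝ → ℝ, IsClassicalSolution ℓ T₁ ϖ v φ w := by
  set τ : ℝ := min T δ₁ with hτdef
  have hτ0 : 0 < τ := lt_min hT hδ₁
  have hτ : τ ∈ Icc 0 T := ⟨hτ0.le, min_le_left _ _⟩
  have hd : 0 < min δ₁ ℓ := lt_min hδ₁ hℓ
  have hgC := contDiffOn_charSource hℓ hT hϖ hv hφ
  obtain ⟨M, hM, hF⟩ :=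
    exists_isC11Field_extendCoef hℓ hT hτ (hv.contDiffOn_charSpeed hℓ hT) hgC
  set ρ : ℝ := min (1 / 2) (min δ₁ ℓ / 2) with hρdef
  have hρ : 0 < ρ := lt_min (by norm_num) (by linarith)
  -- the denominators only have to dominate `2 * M` and `6 * M` and to be positive
  set ε : ℝ := min (ρ / (2 * M + 1)) (1 / (6 * M + 1)) with hεdef
  have hε : 0 < ε := lt_min (by positivity) (by positivity)
  have hMε : 2 * M * ε ≤ ρ := by
    have := (le_div_iff₀ (by positivity)).1 (min_le_left (ρ / (2 * M + 1)) (1 / (6 * M + 1)))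
    rw [← hεdef] at this
    linarith
  have hMε' : 3 * M * ε ≤ 1 / 2 := by
    have := (le_div_iff₀ (by positivity)).1 (min_le_right (ρ / (2 * M + 1)) (1 / (6 * M + 1)))
    rw [← hεdef] at this
    linarith
  -- the extended source vanishes to the left of `min δ₁ ℓ`, also for negative `x`
  have hG : ∀ t, ∀ z : ℝ × ℝ, z.1 ≤ 2 * ρ → extendCoef ℓ T τ (charSource ℓ T ϖ v φ) t z = 0 := by
    intro t z hz
    have hzd : z.1 ≤ min δ₁ ℓ := by linarith [min_le_right (1 / 2) (min δ₁ ℓ / 2)]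
    have hx : clamp ℓ z.1 ∈ Icc 0 (min δ₁ ℓ) :=
      ⟨(clamp_mem hℓ.le _).1, max_le hd.le ((min_le_right _ _).trans hzd)⟩
    have ht : clamp τ t ∈ Icc 0 τ := clamp_mem hτ0.le t
    have h0 : ∀ y ∈ Icc 0 (min δ₁ ℓ), charSource ℓ T ϖ v φ (z.2, y, clamp τ t) = 0 :=
      fun y hy => charSource_left_eq_zero hℓ hδ₁ hv hφ z.2 hy ht
    rw [extendCoef, h0 _ hx, partialX_eq_zero_of_const hgC hd (min_le_right _ _)
      (Icc_subset_Icc_right hτ.2 ht) h0 hx, zero_mul, add_zero]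
  obtain ⟨w, hwC, hweq, hw0, hwl⟩ := hF.exists_quasilinear_solution hℓ hρ (min_le_left _ _) hε hM
    hMε hMε' hG
  -- up to time `τ` the extended coefficients agree with the given ones
  set T₁ : ℝ := min (ε / 2) τ with hT₁def
  have hT₁ : 0 < T₁ := lt_min (by linarith) hτ0
  have hT₁T : T₁ ≤ T := (min_le_right _ _).trans hτ.2
  have hsub : Icc 0 T₁ ⊆ Ioo (-ε) ε := fun t ht =>
    ⟨by linarith [ht.1], by linarith [ht.2, min_le_left (ε / 2) τ]⟩
  have hwR : ContDiffOn ℝ 1 (fun p : ℝ × ℝ => w (p.1, p.2)) (Icc 0 ℓ ×ˢ Icc 0 T₁) :=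
    fun p hp => (hwC p.1 hp.1 p.2 (hsub hp.2)).contDiffWithinAt
  refine ⟨T₁, ⟨hT₁, hT₁T⟩, fun x t => w (x, t), hwR, fun x hx t ht => ?_,
    fun t ht => hwl t (hsub ht), hw0⟩
  have hxI := Ioo_subset_Icc_self hx
  have htI := Ioo_subset_Icc_self ht
  have htτ : t ∈ Icc 0 τ := ⟨htI.1, htI.2.trans (min_le_right _ _)⟩
  refine (conservative_iff_nonconservative (w := fun x t => w (x, t)) hv hT₁T hwR hx ht).2 ?_
  have heq := hweq x hxI t (hsub htI)
  have hfd : fderivWithin ℝ (fun p : ℝ × ℝ => w (p.1, p.2)) (Icc 0 ℓ ×ˢ Icc 0 T₁) (x, t)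
      = fderiv ℝ w (x, t) :=
    fderivWithin_of_mem_nhds (prod_mem_nhds (Icc_mem_nhds hx.1 hx.2) (Icc_mem_nhds ht.1 ht.2))
  rw [extendCoef_of_mem (z := (x, w (x, t))) hxI htτ,
    extendCoef_of_mem (z := (x, w (x, t))) hxI htτ] at heq
  dsimp only at heq
  have hsplit : ∀ c : ℝ, ((c, 1) : ℝ × ℝ) = (0, 1) + c • (1, 0) := fun c => by ext <;> simp
  rw [hsplit, map_add, map_smul, smul_eq_mul] at heq
  rw [hfd]
  exact heq

theorem proposition1 (ℓ T δ₁ : ℝ) (hℓ : 0 < ℓ) (hT : 0 < T) (hδ₁ : 0 < δ₁)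
    (ϖ : Set Plane) (hϖ : IsCrossSection ϖ)
    (v : ℝ → ℝ → ℝ → ℝ) (φ : ℝ → ℝ → Plane → ℝ → ℝ)
    (hv : VelocityAssumption ℓ T δ₁ v)
    (hφ : InteractionAssumption ℓ T δ₁ ϖ φ)
    (hφ₀ : ∀ s, ∀ x ∈ Icc 0 ℓ, ∀ ξ ∈ closure ϖ, φ s x ξ 0 = 0)
    (hspeed : ∀ s, ∀ t ∈ Icc 0 T, 0 < v s 0 t + s * deriv (fun r => v r 0 t) s)
    (hsign_phi : ∀ s, 0 ≤ s → ∀ x ∈ Icc 0 ℓ, ∀ t ∈ Icc 0 T, phiHat ϖ φ s x t ≤ 0)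
    (hsign_v : ∀ s, 0 ≤ s → ∀ x ∈ Icc 0 ℓ, ∀ t ∈ Icc 0 T,
      derivWithin (fun y => v s y t) (Icc 0 ℓ) x ≤ 0) :
    ∃ T₁ ∈ Ioc 0 T, ∃ w : ℝ → ℝ → ℝ,
      IsClassicalSolution ℓ T₁ ϖ v φ w ∧
      (∀ w' : ℝ → ℝ → ℝ, IsClassicalSolution ℓ T₁ ϖ v φ w' →
        ∀ x ∈ Icc 0 ℓ, ∀ t ∈ Icc 0 T₁, w' x t = w x t) ∧
      (∀ x ∈ Icc 0 ℓ, ∀ t ∈ Icc 0 T₁, 0 ≤ w x t) ∧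
      (∀ x ∈ Icc 0 ℓ, HasDerivWithinAt (fun τ => w x τ) 0 (Icc 0 T₁) 0) ∧
      (∀ x ∈ Icc 0 ℓ, HasDerivWithinAt (fun y => w y 0) 0 (Icc 0 ℓ) x) := by
  obtain ⟨T₁, hT₁, w, hw⟩ := exists_isClassicalSolution hℓ hT hδ₁ hϖ hv hφ
  refine ⟨T₁, hT₁, w, hw, fun w' hw' x hx t ht => le_antisymm ?_ ?_, ?_, fun x hx => ?_,
    fun x hx => ?_⟩
  · exact hw'.le hℓ hT hδ₁ hT₁.1 hT₁.2 hϖ hv hφ hw x hx t ht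
  · exact hw.le hℓ hT hδ₁ hT₁.1 hT₁.2 hϖ hv hφ hw' x hx t ht
  · exact hw.nonneg hℓ hT hδ₁ hT₁.1 hT₁.2 hϖ hv hφ (hsign_phi 0 le_rfl)
  · exact hw.hasDerivWithinAt_time_zero hℓ hT hT₁.1 hT₁.2 hϖ hv hφ (hφ₀ 0) hx
  · exact (hasDerivWithinAt_const x _ 0).congr_of_mem (fun y hy => hw.initial y hy) hx
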